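/- Let $\mathscr{C}$ be a biclique-free class of finite simple graphs, i.e. there is a number $d$ such that no graph in $\mathscr{C}$ contains the complete bipartite graph $K_{d,d}$ as a (not necessarily induced) subgraph. Then \textsc{Dominating Set Discovery}, parameterized by the number $k$ of tokens, has a polynomial kernel on $\mathscr{C}$. Here an instance of \textsc{Dominating Set Discovery} is a triple $(G,S,b)$ consisting of a graph $G$, a set $S\subseteq V(G)$ with $|S|=k$, and a budget $b\in\mathbb{N}$, encoded in binary. It is a yes-instance if there are $\ell\le b$ and sets $C_0,\dots,C_\ell\subseteq V(G)$ such that $C_0=S$, $C_\ell$ is a dominating set of $G$, and for each $i<\ell$ one has $C_{i+1}=(C_i\setminus\{y\})\cup\{x\}$ for some $y\in C_i$ and $x\notin C_i$ with $xy\in E(G)$. A polynomial kernel on $\mathscr{C}$ is an algorithm which, given an instance $(G,S,b)$ with $G\in\mathscr{C}$, computes in time polynomial in the size of the instance an instance $(G',S',b')$ such that $(G',S',b')$ is a yes-instance if and only if $(G,S,b)$ is, the size of $(G',S',b')$ and its parameter $k'=|S'|$ are bounded by a polynomial in $k=|S|$, and $G'$ is isomorphic to an induced subgraph of a graph in $\mathscr{C}$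 (so that $G'\in\mathscr{C}$ if $\mathscr{C}$ is closed under induced subgraphs and isomorphism). The algorithm and the polynomials may depend on $\mathscr{C}$, but not on the instance. -/

import Mathlib

namespace DSDiscovery

/-! ## The machine model: a random access machine with structured programs

The memory is a map `ℕ → ℕ`.  Expressions allow constants, (indirect) reading, addition and
truncated subtraction, each at unit cost.  There is no unit-cost multiplication, so that after `t`
steps all numbers have at most `O(t)` bits more than the input numbers; running times on this
machine and on a multi-tape Turing machine are therefore polynomially related. -/

/-- The contents of the memory. -/
abbrev Memory : Type := ℕ → ℕ

/-- Arithmetic expressions. -/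
inductive Expr : Type
  /-- a constant -/
  | lit (c : ℕ) : Expr
  /-- the contents of the cell whose address is the value of `e` -/
  | read (e : Expr) : Expr
  | add (e₁ e₂ : Expr) : Expr
  /-- truncated subtraction -/
  | sub (e₁ e₂ : Expr) : Expr

/-- The value of an expression in a memory. -/
def Expr.val (m : Memory) : Expr → ℕ
  | .lit c => c
  | .read e => m (e.val m)
  | .add e₁ e₂ => e₁.val m + e₂.val m
  | .sub e₁ e₂ => e₁.val m - e₂.val m

/-- The number of steps needed to evaluate an expression: one for each of its operations. -/
def Expr.cost : Expr → ℕ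
  | .lit _ => 1
  | .read e => e.cost + 1
  | .add e₁ e₂ => e₁.cost + e₂.cost + 1
  | .sub e₁ e₂ => e₁.cost + e₂.cost + 1

/-- Programs. -/
inductive Program : Type
  | skip : Program
  /-- write the value of `e` into the cell whose address is the value of `a` -/
  | write (a e : Expr) : Program
  | seq (P Q : Program) : Program
  /-- execute `P` if the value of `e` is nonzero, and `Q` otherwise -/
  | cond (e : Expr) (P Q : Program) : Program
  /-- as long as the value of `e` is nonzero, execute `P` -/
  | loop (e : Expr) (P : Program) : Program

/-- `Exec P m t m'`: started on the memory `m`, the program `P` halts after exactly `t` steps, with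
memory `m'`. -/
inductive Exec : Program → Memory → ℕ → Memory → Prop
  | skip (m : Memory) : Exec .skip m 1 m
  | write (a e : Expr) (m : Memory) :
      Exec (.write a e) m (a.cost + e.cost + 1) (Function.update m (a.val m) (e.val m))
  | seq {P Q : Program} {m₁ m₂ m₃ : Memory} {s t : ℕ} :
      Exec P m₁ s m₂ → Exec Q m₂ t m₃ → Exec (.seq P Q) m₁ (s + t) m₃
  | cond_pos {e : Expr} {P Q : Program} {m m' : Memory} {t : ℕ} :
      e.val m ≠ 0 → Exec P m t m' → Exec (.cond e P Q) m (e.cost + 1 + t) m'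
  | cond_zero {e : Expr} {P Q : Program} {m m' : Memory} {t : ℕ} :
      e.val m = 0 → Exec Q m t m' → Exec (.cond e P Q) m (e.cost + 1 + t) m'
  | loop_pos {e : Expr} {P : Program} {m₁ m₂ m₃ : Memory} {s t : ℕ} :
      e.val m₁ ≠ 0 → Exec P m₁ s m₂ → Exec (.loop e P) m₂ t m₃ →
        Exec (.loop e P) m₁ (e.cost + 1 + s + t) m₃
  | loop_zero {e : Expr} {P : Program} {m : Memory} :
      e.val m = 0 → Exec (.loop e P) m (e.cost + 1) m

/-- The memory that holds the word `w`: its length in cell `0`, its letters in the cells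
`1, …, w.length`, and `0` everywhere else. -/
def load (w : List ℕ) : Memory
  | 0 => w.length
  | i + 1 => w.getD i 0

/-- Started on the input word `w`, the program `P` halts after at most `T` steps with the word `v`
as its output.  (Cells behind the output word may contain anything.) -/
def OutputsWithin (P : Program) (w v : List ℕ) (T : ℕ) : Prop :=
  ∃ (t : ℕ) (m : Memory), t ≤ T ∧ Exec P (load w) t m ∧ ∀ i ≤ v.length, m i = load v i

/-- The size of a word of natural numbers: the total length of the binary representations of its
letters, plus one separator for each letter. -/
def wordSize (w : List ℕ) : ℕ := (w.map fun a => Nat.size a + 1).sum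

/-! ## Graph classes -/

/-- A class of finite graphs; vertex sets are of the form `{0, …, n - 1}`. The class need not be
closed under isomorphism. -/
abbrev GraphClass : Type := ∀ n : ℕ, Set (SimpleGraph (Fin n))

/-- There is a number `d` such that no graph of the class contains `K_{d,d}` as a (not necessarily
induced) subgraph. -/
def GraphClass.BicliqueFree (𝒞 : GraphClass) : Prop :=
  ∃ d : ℕ, ∀ (n : ℕ), ∀ G ∈ 𝒞 n, (completeBipartiteGraph (Fin d) (Fin d)).Free G

/-- The class of all graphs that are isomorphic to an induced subgraph of a member of `𝒞`. -/
def GraphClass.hereditaryClosure (𝒞 : GraphClass) : GraphClass :=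
  fun _ => {H | ∃ n : ℕ, ∃ G ∈ 𝒞 n, H.IsIndContained G}

/-! ## Dominating Set Discovery in the token sliding model -/

/-- Every vertex lies in `D` or has a neighbour in `D`. -/
def IsDominatingSet {n : ℕ} (G : SimpleGraph (Fin n)) (D : Finset (Fin n)) : Prop :=
  ∀ v, v ∈ D ∨ ∃ u ∈ D, G.Adj u v

/-- `C ⊢ C'`: one token of the configuration `C` slides along an edge to an unoccupied vertex. -/
def Slide {n : ℕ} (G : SimpleGraph (Fin n)) (C C' : Finset (Fin n)) : Prop :=
  ∃ y ∈ C, ∃ x, x ∉ C ∧ G.Adj x y ∧ C' = insert x (C.erase y)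

/-- An instance `(G, S, b)` of Dominating Set Discovery. -/
structure Instance : Type where
  /-- the number of vertices -/
  n : ℕ
  G : SimpleGraph (Fin n)
  /-- the initial configuration -/
  S : Finset (Fin n)
  /-- the budget -/
  b : ℕ

/-- The parameter `k`: the number of tokens. -/
def Instance.tokens (I : Instance) : ℕ := I.S.card

/-- `I` is a yes-instance: some discovery sequence `C 0 ⊢ C 1 ⊢ ⋯ ⊢ C ℓ` with `ℓ ≤ b` starts in
`S` and ends in a dominating set. -/
def Instance.IsYes (I : Instance) : Prop :=
  ∃ (l : ℕ) (C : ℕ → Finset (Fin I.n)), l ≤ I.b ∧ C 0 = I.S ∧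
    (∀ i < l, Slide I.G (C i) (C (i + 1))) ∧ IsDominatingSet I.G (C l)

open Classical in
/-- The encoding of an instance as a word: the number of vertices, the budget, the adjacency matrix
row by row, and the characteristic vector of the initial configuration. -/
noncomputable def Instance.encode (I : Instance) : List ℕ :=
  I.n :: I.b ::
    (((List.finRange I.n).flatMap fun u =>
        (List.finRange I.n).map fun v => if I.G.Adj u v then 1 else 0) ++
      (List.finRange I.n).map fun v => if v ∈ I.S then 1 else 0)

/-- The size of an instance. -/
noncomputable def Instance.size (I : Instance) : ℕ := wordSize I.encode

/-- Dominating Set Discovery, parameterized by the number `k` of tokens, has a polynomial kernel on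
`𝒞`: some program `P` computes, for every instance `I` whose graph lies in `𝒞`, in time polynomial
in the size of `I`, an equivalent instance `f I` whose size and parameter are bounded by a
polynomial in the parameter of `I`, and whose graph is again one of `𝒞` or an induced subgraph of
such a graph. -/
def HasPolynomialKernelOn (𝒞 : GraphClass) : Prop :=
  ∃ (P : Program) (f : Instance → Instance) (p q : Polynomial ℕ),
    ∀ I : Instance, I.G ∈ 𝒞 I.n →
      OutputsWithin P I.encode (f I).encode (p.eval I.size) ∧
      ((f I).IsYes ↔ I.IsYes) ∧
      (f I).size ≤ q.eval I.tokens ∧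
      (f I).tokens ≤ q.eval I.tokens ∧
      (f I).G ∈ 𝒞.hereditaryClosure (f I).n

end DSDiscovery

/-!
Let `k` be the number of tokens. A graph without `K_{d,d}` has a small *domination core* `C`: any
`k` vertices that dominate `C` dominate the whole graph. It is found greedily, leaving out a vertex
if some set `X` of at most `d` of its closed neighbours already has so many common closed neighbours
in `C` that `k` vertices can only dominate them all if one of them lies in `X`. A set of `d`
vertices never has that many common closed neighbours, and for `X = ∅` the rule stops the process
while the size of `C` is still polynomial in `k`.

All that matters about the target of a token is its *trace*, the set of its closed neighbours in
`C`, and its distance from the token. Since `K_{d,d}` is excluded, there are only polynomially many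
traces. Tokens are indistinguishable, so blocked tokens can exchange their targets; hence moving the
tokens to an assignment of targets costs no more than the sum of the distances, and each token may
be sent to the nearest vertex with the trace of its target. In a graph that is dominated by `k`
vertices, no finite distance exceeds `3 * k`. So the core, the tokens, and one shortest path from
each token to its nearest vertex with each trace induce an equivalent instance, with the budget
lowered to `3 * k * k` if it is larger.

The kernel is defined by formulas over the adjacency matrix, the token set, and finitely many tables
that are filled one after the other. These formulas are terms of a language whose only unbounded
construct is summation over an interval of polynomial length, so that every term compiles to a
program that runs in polynomial time.
-/

namespace DSDiscovery

open Finset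

/-! ## Domination cores -/

section Core

variable {V : Type*} {G : SimpleGraph V} {d k : ℕ} {C X : Finset V} {u v : V}

/-- `u` lies in the closed neighbourhood of `v`. -/
def ClosedAdj (G : SimpleGraph V) (u v : V) : Prop := u = v ∨ G.Adj u v

theorem ClosedAdj.symm (h : ClosedAdj G u v) : ClosedAdj G v u :=
  h.imp Eq.symm fun h => h.symm

open Classical in
/-- The elements of `C` whose closed neighbourhood contains `X`. -/
noncomputable def commonClosedNeighbors (G : SimpleGraph V) (C X : Finset V) : Finset V :=
  C.filter fun u => ∀ x ∈ X, ClosedAdj G x u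

theorem mem_commonClosedNeighbors :
    u ∈ commonClosedNeighbors G C X ↔ u ∈ C ∧ ∀ x ∈ X, ClosedAdj G x u := by
  simp [commonClosedNeighbors]

theorem card_commonClosedNeighbors_lt (hG : (completeBipartiteGraph (Fin d) (Fin d)).Free G)
    (C : Finset V) (hX : #X = d) : #(commonClosedNeighbors G C X) < 2 * d := by
  classical
  by_contra! h
  have hcard : d ≤ #(commonClosedNeighbors G C X \ X) := by
    have := le_card_sdiff X (commonClosedNeighbors G C X)
    omega
  obtain ⟨Y, hY, hYd⟩ := exists_subset_card_eq hcard
  refine hG (SimpleGraph.completeBipartiteGraph_isContained_iff.mpr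
    ⟨X, Y, by simp [hX], by simp [hYd], fun x hx y hy => ?_⟩)
  obtain ⟨hyC, hyX⟩ := mem_sdiff.mp (hY hy)
  refine ((mem_commonClosedNeighbors.mp hyC).2 x hx).resolve_left ?_
  rintro rfl
  exact hyX hx

/-- The number of common closed neighbours that a set of `d - i` vertices may have in a core. The
recursion makes room for `k` sets that have one vertex more. -/
def coreBound (d k : ℕ) : ℕ → ℕ
  | 0 => 2 * d
  | i + 1 => k * coreBound d k i + 1

/-- `C` arises by adding the vertices greedily in increasing order, where a vertex is skipped if
some set `X` of at most `d` vertices in its closed neighbourhood already has many common closed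
neighbours in `C`: `k` vertices can then only dominate those common neighbours if one of the `k`
vertices lies in `X`. -/
def IsCore [LinearOrder V] (G : SimpleGraph V) (d k : ℕ) (C : Finset V) : Prop :=
  ∀ v, v ∈ C ↔ ¬ ∃ X : Finset V, #X ≤ d ∧ (∀ x ∈ X, ClosedAdj G x v) ∧
    coreBound d k (d - #X) ≤ #{u ∈ commonClosedNeighbors G C X | u < v}

variable [LinearOrder V]

theorem IsCore.card_commonClosedNeighbors_le (hC : IsCore G d k C) (hX : #X ≤ d) :
    #(commonClosedNeighbors G C X) ≤ coreBound d k (d - #X) := by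
  rcases (commonClosedNeighbors G C X).eq_empty_or_nonempty with h | h
  · simp [h]
  set v := (commonClosedNeighbors G C X).max' h
  obtain ⟨hvC, hXv⟩ := mem_commonClosedNeighbors.mp (max'_mem _ h)
  have hfew : #{u ∈ commonClosedNeighbors G C X | u < v} < coreBound d k (d - #X) := by
    by_contra! hmany
    exact (hC v).mp hvC ⟨X, hX, hXv, hmany⟩
  have hsub : commonClosedNeighbors G C X ⊆
      insert v {u ∈ commonClosedNeighbors G C X | u < v} := fun u hu => by
    rcases (le_max' _ u hu).eq_or_lt with h | h <;> simp [h, hu, v]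
  exact (card_le_card hsub).trans ((card_insert_le _ _).trans hfew)

theorem IsCore.card_le (hC : IsCore G d k C) : #C ≤ coreBound d k d := by
  simpa [commonClosedNeighbors] using hC.card_commonClosedNeighbors_le (X := ∅) (by simp)

/-- Induction step of the counting argument: the common neighbours are dominated by `D`, and each
`u ∈ D` outside `X` dominates only those that it has in common with `X`. -/
theorem IsCore.card_commonClosedNeighbors_le_mul (hC : IsCore G d k C) (hX : #X < d)
    {D : Finset V} (hD : #D ≤ k) (hDC : ∀ c ∈ C, ∃ u ∈ D, ClosedAdj G u c)
    (hDX : Disjoint D X) :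
    #(commonClosedNeighbors G C X) ≤ k * coreBound d k (d - (#X + 1)) := by
  have hsub : commonClosedNeighbors G C X ⊆
      D.biUnion fun u => commonClosedNeighbors G C (insert u X) := fun c hc => by
    obtain ⟨hcC, hXc⟩ := mem_commonClosedNeighbors.mp hc
    obtain ⟨u, hu, huc⟩ := hDC c hcC
    exact mem_biUnion.mpr ⟨u, hu, mem_commonClosedNeighbors.mpr
      ⟨hcC, forall_mem_insert _ _ _ |>.mpr ⟨huc, hXc⟩⟩⟩
  refine ((card_le_card hsub).trans (card_biUnion_le_card_mul _ _ _ fun u hu => ?_)).trans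
    (Nat.mul_le_mul_right _ hD)
  have hcard : #(insert u X) = #X + 1 := card_insert_of_notMem (disjoint_left.mp hDX hu)
  simpa [hcard] using hC.card_commonClosedNeighbors_le (X := insert u X) (by omega)

theorem IsCore.dominates (hC : IsCore G d k C)
    (hG : (completeBipartiteGraph (Fin d) (Fin d)).Free G) {D : Finset V} (hD : #D ≤ k)
    (hDC : ∀ c ∈ C, ∃ u ∈ D, ClosedAdj G u c) (v : V) : ∃ u ∈ D, ClosedAdj G u v := by
  by_cases hv : v ∈ C
  · exact hDC v hv
  obtain ⟨X, hXd, hXv, hX⟩ := not_not.mp (mt (hC v).mpr hv)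
  have hmany : coreBound d k (d - #X) ≤ #(commonClosedNeighbors G C X) :=
    hX.trans (card_filter_le _ _)
  rcases hXd.lt_or_eq with hlt | rfl
  · by_contra! hno
    have hDX : Disjoint D X := disjoint_left.mpr fun u hu hx => hno u hu (hXv u hx)
    have hfew := hC.card_commonClosedNeighbors_le_mul hlt hD hDC hDX
    rw [show d - #X = d - (#X + 1) + 1 by omega, coreBound] at hmany
    omega
  · have hfew := card_commonClosedNeighbors_lt hG C rfl
    rw [Nat.sub_self, coreBound] at hmany
    omega

end Core

/-! ## Traces on the core -/

section Trace

variable {V : Type*} {G : SimpleGraph V} {C : Finset V} {c v : V}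

open Classical in
/-- The closed neighbours of `v` in `C`. As far as dominating `C` is concerned, vertices with the
same trace are interchangeable. -/
noncomputable def trace (G : SimpleGraph V) (C : Finset V) (v : V) : Finset V :=
  C.filter (ClosedAdj G v)

theorem mem_trace : c ∈ trace G C v ↔ c ∈ C ∧ ClosedAdj G v c := by
  simp [trace]

theorem trace_eq_trace_iff {u : V} :
    trace G C u = trace G C v ↔ ∀ c ∈ C, ClosedAdj G u c ↔ ClosedAdj G v c := by
  simp only [Finset.ext_iff, mem_trace, and_congr_right_iff]

/-- A trace with fewer than `d` elements is one of few subsets of `C`; a larger one belongs to one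
of the few common closed neighbours of some `d` elements of `C`. -/
theorem card_image_trace_le [Fintype V] [DecidableEq V] {d : ℕ}
    (hG : (completeBipartiteGraph (Fin d) (Fin d)).Free G) (C : Finset V) :
    #(univ.image (trace G C)) ≤ d * (#C + 1) ^ d + #C ^ d * (2 * d) := by
  have hsub : univ.image (trace G C) ⊆
      ((range d).biUnion fun i => C.powersetCard i) ∪
      ((C.powersetCard d).biUnion fun X => commonClosedNeighbors G univ X).image
        (trace G C) := by
    intro T hT
    obtain ⟨v, -, rfl⟩ := mem_image.mp hT
    have hTC : trace G C v ⊆ C := fun c hc => (mem_trace.mp hc).1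
    rcases lt_or_ge #(trace G C v) d with hlt | hge
    · exact mem_union_left _ (mem_biUnion.mpr
        ⟨_, mem_range.mpr hlt, mem_powersetCard.mpr ⟨hTC, rfl⟩⟩)
    · obtain ⟨X, hX, hXd⟩ := exists_subset_card_eq hge
      exact mem_union_right _ (mem_image_of_mem _ (mem_biUnion.mpr
        ⟨X, mem_powersetCard.mpr ⟨hX.trans hTC, hXd⟩, mem_commonClosedNeighbors.mpr
          ⟨mem_univ _, fun x hx => (mem_trace.mp (hX hx)).2.symm⟩⟩))
  have hsmall : ∀ i ∈ range d, #(C.powersetCard i) ≤ (#C + 1) ^ d := fun i hi =>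
    calc #(C.powersetCard i) = (#C).choose i := card_powersetCard _ _
      _ ≤ #C ^ i := Nat.choose_le_pow _ _
      _ ≤ (#C + 1) ^ i := by gcongr; omega
      _ ≤ (#C + 1) ^ d := by gcongr; exacts [by omega, (mem_range.mp hi).le]
  have hlarge : #((C.powersetCard d).biUnion fun X => commonClosedNeighbors G univ X) ≤
      #C ^ d * (2 * d) :=
    (card_biUnion_le_card_mul _ _ (2 * d) fun X hX =>
      (card_commonClosedNeighbors_lt hG _ (mem_powersetCard.mp hX).2).le).trans
      (Nat.mul_le_mul_right _ ((card_powersetCard d C).trans_le (Nat.choose_le_pow _ _)))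
  refine (card_le_card hsub).trans ((card_union_le _ _).trans
    (add_le_add ?_ (card_image_le.trans hlarge)))
  simpa using card_biUnion_le_card_mul (range d) _ _ hsmall

end Trace

/-! ## Distances -/

section Distance

variable {V : Type*} {G : SimpleGraph V} {s u v w : V}

theorem closedAdj_iff_edist_le_one : ClosedAdj G u v ↔ G.edist u v ≤ 1 := by
  rw [SimpleGraph.edist_le_one_iff_adj_or_eq, or_comm, ClosedAdj]

theorem exists_edist_eq_edist_eq {i l : ℕ} (h : G.edist u v = l) (hi : i ≤ l) :
    ∃ x, G.edist u x = i ∧ G.edist x v = (l - i : ℕ) := by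
  obtain ⟨p, hp⟩ := SimpleGraph.exists_walk_of_edist_eq_coe h
  have h₁ : G.edist u (p.getVert i) ≤ i := by
    simpa [hp, hi] using (p.take i).edist_le
  have h₂ : G.edist (p.getVert i) v ≤ (l - i : ℕ) := by
    simpa [hp] using (p.drop i).edist_le
  have htri : (l : ℕ∞) ≤ G.edist u (p.getVert i) + G.edist (p.getVert i) v :=
    h ▸ G.edist_triangle
  refine ⟨p.getVert i, ?_⟩
  lift G.edist u (p.getVert i) to ℕ using ne_top_of_le_ne_top (ENat.natCast_ne_top _) h₁ with a
  lift G.edist (p.getVert i) v to ℕ using ne_top_of_le_ne_top (ENat.natCast_ne_top _) h₂ with b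
  norm_cast at *
  omega

theorem edist_le_add_one_iff {r : ℕ} :
    G.edist s v ≤ r + 1 ↔ ∃ u, G.edist s u ≤ r ∧ ClosedAdj G u v := by
  constructor
  · intro h
    obtain ⟨l, hl⟩ := ENat.ne_top_iff_exists.mp
      (ne_top_of_le_ne_top (ENat.natCast_ne_top (r + 1)) (by exact_mod_cast h))
    have hlr : l ≤ r + 1 := by exact_mod_cast hl ▸ h
    obtain ⟨u, hsu, huv⟩ := exists_edist_eq_edist_eq hl.symm (Nat.sub_le l 1)
    refine ⟨u, ?_, closedAdj_iff_edist_le_one.mpr ?_⟩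
    · rw [hsu]; exact_mod_cast (by omega : l - 1 ≤ r)
    · rw [huv]; exact_mod_cast (by omega : l - (l - 1) ≤ 1)
  · rintro ⟨u, hsu, huv⟩
    exact G.edist_triangle.trans (add_le_add hsu (closedAdj_iff_edist_le_one.mp huv))

/-- On a longer shortest path, two vertices at distance at least three would be dominated by the
same element of `D`. -/
theorem edist_le_three_mul_card {D : Finset V} (hD : ∀ v, ∃ u ∈ D, ClosedAdj G u v)
    (h : G.edist s v ≠ ⊤) : G.edist s v ≤ 3 * #D := by
  obtain ⟨p, hp⟩ := SimpleGraph.exists_walk_of_edist_ne_top h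
  rw [← hp]
  by_contra! hlt
  norm_cast at hlt
  choose f hfD hf using hD
  obtain ⟨i, hi, j, hj, hij, heq⟩ := exists_ne_map_eq_of_card_lt_of_maps_to
    (s := range (#D + 1)) (t := D) (f := fun i => f (p.getVert (3 * i))) (by simp)
    (fun i _ => hfD _)
  wlog hlt' : i < j generalizing i j
  · exact this j hj i hi hij.symm heq.symm (by omega)
  have hshort : G.edist (p.getVert (3 * i)) (p.getVert (3 * j)) ≤ 1 + 1 :=
    G.edist_triangle.trans (add_le_add (closedAdj_iff_edist_le_one.mp (hf _).symm)
      (closedAdj_iff_edist_le_one.mp (by simpa only [heq] using hf (p.getVert (3 * j)))))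
  have hcut : (p.length : ℕ∞) ≤ (3 * i : ℕ) + (1 + 1) + (p.length - 3 * j : ℕ) := by
    rw [hp]
    calc G.edist s v
        ≤ G.edist s (p.getVert (3 * i)) + G.edist (p.getVert (3 * i)) (p.getVert (3 * j)) +
            G.edist (p.getVert (3 * j)) v :=
          G.edist_triangle.trans (add_le_add_left G.edist_triangle _)
      _ ≤ _ := by
        refine add_le_add (add_le_add ((p.take _).edist_le.trans ?_) hshort)
          ((p.drop _).edist_le.trans ?_)
        · rw [SimpleGraph.Walk.take_length]; exact_mod_cast min_le_left _ _
        · rw [SimpleGraph.Walk.drop_length]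
  norm_cast at hcut
  simp only [mem_range] at hj
  omega

theorem edist_le_edist_comap {V' : Type*} (e : V' → V) (u v : V') :
    G.edist (e u) (e v) ≤ (G.comap e).edist u v :=
  le_iInf fun p =>
    let f : G.comap e →g G := ⟨e, id⟩
    (p.map f).edist_le.trans_eq (by rw [SimpleGraph.Walk.length_map])

end Distance

/-! ## The vertices of the kernel -/

section KernelVertices

variable {V : Type*} [LinearOrder V] {G : SimpleGraph V} {S C : Finset V} {s u v w : V} {t : ℕ}

/-- Among the vertices with its trace, `v` is the one closest to the token `s`, ties being broken
by the order on the vertices. -/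
structure IsRepresentative (G : SimpleGraph V) (S C : Finset V) (s v : V) : Prop where
  mem : s ∈ S
  edist_le : G.edist s v ≤ 3 * #S
  min : ∀ u, trace G C u = trace G C v → toLex (G.edist s v, v) ≤ toLex (G.edist s u, u)

/-- `v` is the predecessor of `w` on the canonical shortest path from `s` to `w`: the least
neighbour of `w` that is closer to `s`. -/
def IsParent (G : SimpleGraph V) (s w v : V) : Prop :=
  IsLeast {u | G.Adj u w ∧ G.edist s u + 1 = G.edist s w} v

/-- `v` is the vertex `t` steps before the end of the canonical shortest path from the token `s`
to one of its representatives. -/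
inductive OnGeodesic (G : SimpleGraph V) (S C : Finset V) : ℕ → V → V → Prop
  | zero {s v : V} : IsRepresentative G S C s v → OnGeodesic G S C 0 s v
  | succ {t : ℕ} {s w v : V} :
      OnGeodesic G S C t s w → IsParent G s w v → OnGeodesic G S C (t + 1) s v

open Classical in
/-- The vertices that are kept in the kernel: the core, the tokens, and the canonical shortest
paths from the tokens to their representatives. -/
noncomputable def kernelVertices [Fintype V] (G : SimpleGraph V) (S C : Finset V) : Finset V :=
  C ∪ S ∪ univ.filter fun v => ∃ t s, OnGeodesic G S C t s v

theorem mem_kernelVertices [Fintype V] :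
    v ∈ kernelVertices G S C ↔ v ∈ C ∨ v ∈ S ∨ ∃ t s, OnGeodesic G S C t s v := by
  simp [kernelVertices]

theorem exists_isRepresentative [Finite V] (hs : s ∈ S) (hv : G.edist s v ≤ 3 * #S) :
    ∃ u, IsRepresentative G S C s u ∧ trace G C u = trace G C v ∧ G.edist s u ≤ G.edist s v := by
  classical
  have := Fintype.ofFinite V
  obtain ⟨u, hu, hmin⟩ := exists_min_image {u | trace G C u = trace G C v}
    (fun u => toLex (G.edist s u, u)) ⟨v, by simp⟩
  simp only [mem_filter, mem_univ, true_and] at hu hmin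
  have hle : G.edist s u ≤ G.edist s v := by
    simpa using (Prod.Lex.monotone_fst _ _ (hmin v rfl))
  exact ⟨u, ⟨hs, hle.trans hv, fun w hw => hmin w (hw.trans hu)⟩, hu, hle⟩

theorem IsRepresentative.eq_of_trace_eq (hu : IsRepresentative G S C s u)
    (hv : IsRepresentative G S C s v) (h : trace G C u = trace G C v) : u = v :=
  congr_arg Prod.snd (toLex.injective (le_antisymm (hu.min v h.symm) (hv.min u h)))

theorem exists_isParent [Finite V] (h : G.edist s w ≠ ⊤) (hw : w ≠ s) : ∃ v, IsParent G s w v := by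
  obtain ⟨l, hl⟩ := ENat.ne_top_iff_exists.mp h
  have hpos : l ≠ 0 := by
    rintro rfl
    exact hw (SimpleGraph.edist_eq_zero_iff.mp hl.symm).symm
  obtain ⟨u, hsu, huw⟩ := exists_edist_eq_edist_eq hl.symm (Nat.sub_le l 1)
  rw [show l - (l - 1) = 1 by omega, Nat.cast_one, SimpleGraph.edist_eq_one_iff_adj] at huw
  have hcloser : G.edist s u + 1 = G.edist s w := by
    rw [hsu, ← hl]
    exact_mod_cast (by omega : l - 1 + 1 = l)
  exact Set.exists_min_image _ id (Set.toFinite _) ⟨u, huw, hcloser⟩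

theorem OnGeodesic.mem (h : OnGeodesic G S C t s v) : s ∈ S := by
  induction h with
  | zero h => exact h.mem
  | succ _ _ ih => exact ih

theorem OnGeodesic.add_edist_le (h : OnGeodesic G S C t s v) : t + G.edist s v ≤ 3 * #S := by
  induction h with
  | zero h => simpa using h.edist_le
  | succ _ h ih => rwa [← h.1.2, add_comm (G.edist _ _), ← add_assoc] at ih

theorem OnGeodesic.le (h : OnGeodesic G S C t s v) : t ≤ 3 * #S := by
  exact_mod_cast le_self_add.trans h.add_edist_le

theorem OnGeodesic.edist_comap_le [Fintype V] {V' : Type*} {e : V' → V}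
    (he : ∀ v ∈ kernelVertices G S C, v ∈ Set.range e) {s v : V'}
    (h : OnGeodesic G S C t (e s) (e v)) (he' : e.Injective) :
    (G.comap e).edist s v ≤ G.edist (e s) (e v) := by
  have hfin : G.edist (e s) (e v) ≠ ⊤ :=
    ne_top_of_le_ne_top (ENat.natCast_ne_top (3 * #S))
      (by exact_mod_cast le_add_self.trans h.add_edist_le)
  obtain ⟨l, hl⟩ := ENat.ne_top_iff_exists.mp hfin
  induction l generalizing v t with
  | zero =>
    rw [he' (SimpleGraph.edist_eq_zero_iff.mp hl.symm), SimpleGraph.edist_self]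
    simp
  | succ l ih =>
    obtain ⟨x, hx⟩ := exists_isParent hfin (by rintro heq; simp [heq] at hl)
    obtain ⟨u, rfl⟩ := he x (mem_kernelVertices.mpr (.inr (.inr ⟨_, _, h.succ hx⟩)))
    have hlu : (l : ℕ∞) = G.edist (e s) (e u) := by
      have := hx.1.2.trans hl.symm
      exact (WithTop.add_right_cancel ENat.one_ne_top (by exact_mod_cast this)).symm
    have hadj : (G.comap e).Adj u v := hx.1.1
    calc (G.comap e).edist s v
        ≤ (G.comap e).edist s u + (G.comap e).edist u v := SimpleGraph.edist_triangle
      _ ≤ G.edist (e s) (e u) + 1 :=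
        add_le_add (ih (h.succ hx) (hlu ▸ ENat.natCast_ne_top l) hlu)
          (SimpleGraph.edist_eq_one_iff_adj.mpr hadj).le
      _ = G.edist (e s) (e v) := hx.1.2

open Classical in
theorem card_filter_onGeodesic_le [Fintype V] (t : ℕ) (s : V) :
    #{v | OnGeodesic G S C t s v} ≤ #(univ.image (trace G C)) := by
  induction t with
  | zero =>
    refine card_le_card_of_injOn (trace G C) (fun v _ => mem_image_of_mem _ (mem_univ v)) ?_
    intro u hu v hv h
    simp only [coe_filter, mem_univ, true_and, Set.mem_ofPred_eq] at hu hv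
    cases hu with | zero hu => cases hv with | zero hv => exact hu.eq_of_trace_eq hv h
  | succ t ih =>
    refine le_trans ?_ ih
    choose! parent hparent using fun w (h : ∃ v, IsParent G s w v) => h
    refine (card_le_card fun v hv => ?_).trans
      (card_image_le (f := parent) (s := {v | OnGeodesic G S C t s v}))
    cases (mem_filter.mp hv).2 with
    | succ hw hv =>
      exact mem_image.mpr ⟨_, by simpa using hw, (hparent _ ⟨_, hv⟩).unique hv⟩

theorem card_kernelVertices_le [Fintype V] (G : SimpleGraph V) (S C : Finset V) :
    #(kernelVertices G S C) ≤ #C + #S + (3 * #S + 1) * (#S * #(univ.image (trace G C))) := by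
  classical
  have hsub : (univ.filter fun v => ∃ t s, OnGeodesic G S C t s v) ⊆
      (range (3 * #S + 1)).biUnion fun t => S.biUnion fun s => {v | OnGeodesic G S C t s v} := by
    intro v hv
    obtain ⟨t, s, h⟩ := (mem_filter.mp hv).2
    simp only [mem_biUnion, mem_range, mem_filter, mem_univ, true_and]
    exact ⟨t, Nat.lt_succ_of_le h.le, s, h.mem, h⟩
  refine (card_union_le _ _).trans (add_le_add (card_union_le _ _) ((card_le_card hsub).trans ?_))
  simpa using card_biUnion_le_card_mul (range (3 * #S + 1)) _ _ fun t _ =>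
    card_biUnion_le_card_mul S _ _ fun s _ => card_filter_onGeodesic_le t s

end KernelVertices

/-! ## Sequences of slides -/

section Slides

variable {n : ℕ} {G : SimpleGraph (Fin n)} {C C' D D' : Finset (Fin n)} {l : ℕ}

/-- `D` is obtained from `C` by `l` slides. -/
inductive Slides (G : SimpleGraph (Fin n)) : ℕ → Finset (Fin n) → Finset (Fin n) → Prop
  | refl (C : Finset (Fin n)) : Slides G 0 C C
  | step {l : ℕ} {C C' D : Finset (Fin n)} : Slide G C C' → Slides G l C' D → Slides G (l + 1) C D

theorem slides_iff_exists_sequence : Slides G l C D ↔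
    ∃ F : ℕ → Finset (Fin n), F 0 = C ∧ (∀ i < l, Slide G (F i) (F (i + 1))) ∧ F l = D := by
  constructor
  · intro h
    induction h with
    | refl C => exact ⟨fun _ => C, rfl, by simp, rfl⟩
    | @step l C C' D hC _ ih =>
      obtain ⟨F, rfl, hF, rfl⟩ := ih
      refine ⟨fun i => i.casesOn C F, rfl, fun i hi => ?_, rfl⟩
      cases i with
      | zero => exact hC
      | succ i => exact hF i (by omega)
  · rintro ⟨F, rfl, hF, rfl⟩
    induction l generalizing F with
    | zero => exact .refl _
    | succ l ih =>
      exact .step (hF 0 l.succ_pos) (ih (fun i => F (i + 1)) fun i hi => hF (i + 1) (by omega))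

theorem Instance.isYes_iff_exists_slides {I : Instance} :
    I.IsYes ↔ ∃ l ≤ I.b, ∃ D, Slides I.G l I.S D ∧ IsDominatingSet I.G D := by
  simp only [slides_iff_exists_sequence, Instance.IsYes]
  constructor
  · rintro ⟨l, F, hl, h0, hF, hD⟩
    exact ⟨l, hl, F l, ⟨F, h0, hF, rfl⟩, hD⟩
  · rintro ⟨l, hl, D, ⟨F, h0, hF, rfl⟩, hD⟩
    exact ⟨l, F, hl, h0, hF, hD⟩

theorem isDominatingSet_iff : IsDominatingSet G D ↔ ∀ v, ∃ u ∈ D, ClosedAdj G u v := by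
  refine forall_congr' fun v => ⟨?_, ?_⟩
  · rintro (h | ⟨u, hu, h⟩)
    exacts [⟨v, h, .inl rfl⟩, ⟨u, hu, .inr h⟩]
  · rintro ⟨u, hu, rfl | h⟩
    exacts [.inl hu, .inr ⟨u, hu, h⟩]

theorem IsDominatingSet.mono (hD : IsDominatingSet G D) (h : D ⊆ D') : IsDominatingSet G D' :=
  fun v => (hD v).imp (fun hv => h hv) fun ⟨u, hu, huv⟩ => ⟨u, h hu, huv⟩

theorem Slides.exists_image_eq (h : Slides G l C D) :
    ∃ f : Fin n → Fin n, C.image f = D ∧ ∑ c ∈ C, G.edist c (f c) ≤ l := by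
  induction h with
  | refl C => exact ⟨id, image_id, by simp⟩
  | @step l C C' D hC _ ih =>
    obtain ⟨y, hy, x, hx, hxy, rfl⟩ := hC
    obtain ⟨f, rfl, hf⟩ := ih
    have hx' : x ∉ C.erase y := fun h => hx (mem_of_mem_erase h)
    have hf_eq : ∀ c ∈ C.erase y, Function.update f y (f x) c = f c := fun c hc =>
      Function.update_of_ne (ne_of_mem_erase hc) _ _
    refine ⟨Function.update f y (f x), ?_, ?_⟩
    · conv_lhs => rw [← insert_erase hy]
      rw [image_insert, image_insert, Function.update_self, image_congr hf_eq]
    · rw [← add_sum_erase _ _ hy, Function.update_self,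
        sum_congr rfl fun c hc => by rw [hf_eq c hc]]
      rw [sum_insert hx'] at hf
      calc G.edist y (f x) + ∑ c ∈ C.erase y, G.edist c (f c)
          ≤ (1 + G.edist x (f x)) + ∑ c ∈ C.erase y, G.edist c (f c) := by
            gcongr
            exact G.edist_triangle.trans_eq
              (by rw [SimpleGraph.edist_eq_one_iff_adj.mpr hxy.symm])
        _ ≤ (l + 1 : ℕ) := by
            rw [add_assoc, add_comm, Nat.cast_add, Nat.cast_one]
            gcongr

end Slides

section Tokens

variable {V : Type*} {G : SimpleGraph V} {u v : V}

theorem exists_adj_leaving_of_walk {A : Set V} (p : G.Walk u v) (hu : u ∈ A) (hv : v ∉ A) :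
    ∃ s ∈ A, ∃ y ∉ A, G.Adj s y ∧ G.edist u s + 1 + G.edist y v ≤ p.length := by
  induction p with
  | nil => exact absurd hu hv
  | @cons u x v hux p ih =>
    by_cases hx : x ∈ A
    · obtain ⟨s, hs, y, hy, hsy, hle⟩ := ih hx hv
      refine ⟨s, hs, y, hy, hsy, ?_⟩
      have hus : G.edist u s ≤ 1 + G.edist x s :=
        G.edist_triangle.trans_eq (by rw [SimpleGraph.edist_eq_one_iff_adj.mpr hux])
      calc G.edist u s + 1 + G.edist y v ≤ 1 + G.edist x s + 1 + G.edist y v := by gcongr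
        _ = (G.edist x s + 1 + G.edist y v) + 1 := by ring
        _ ≤ (p.cons hux).length := by
          rw [SimpleGraph.Walk.length_cons, Nat.cast_add, Nat.cast_one]
          gcongr
    · refine ⟨u, hu, x, hx, hux, ?_⟩
      rw [SimpleGraph.edist_self, zero_add, SimpleGraph.Walk.length_cons, add_comm, Nat.cast_add]
      exact add_le_add_left p.edist_le 1

variable {ι : Type*} [DecidableEq ι]

theorem injective_update_of_notMem {g : ι → V} (hg : g.Injective) {i : ι} {y : V}
    (hy : y ∉ Set.range g) : (Function.update g i y).Injective := by
  have : ∀ k, g k ≠ y := fun k h => hy ⟨k, h⟩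
  intro a b hab
  by_cases ha : a = i <;> by_cases hb : b = i <;>
    simp_all [Function.update_apply, hg.eq_iff, eq_comm]

variable [Fintype ι]

theorem sum_update_swap_edist_le (g r : ι → V) (i j : ι) (y : V)
    (h : G.edist (g j) (g i) + 1 + G.edist y (r j) ≤ G.edist (g j) (r j)) :
    ∑ k, G.edist (Function.update g i y k) (r (Equiv.swap i j k)) + 1 ≤
      ∑ k, G.edist (g k) (r k) := by
  have hrest : ∑ k ∈ univ \ {i, j}, G.edist (Function.update g i y k) (r (Equiv.swap i j k)) =
      ∑ k ∈ univ \ {i, j}, G.edist (g k) (r k) := sum_congr rfl fun k hk => by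
    simp only [mem_sdiff, mem_univ, mem_insert, mem_singleton, not_or, true_and] at hk
    rw [Function.update_of_ne hk.1, Equiv.swap_apply_of_ne_of_ne hk.1 hk.2]
  rw [← sum_sdiff (subset_univ {i, j}), hrest, ← sum_sdiff (subset_univ {i, j}), add_assoc]
  refine add_le_add_right ?_ _
  by_cases hij : i = j
  · subst hij
    simpa [add_comm] using h
  · rw [sum_pair hij, sum_pair hij, Function.update_self, Equiv.swap_apply_left,
      Function.update_of_ne (Ne.symm hij), Equiv.swap_apply_right]
    calc G.edist y (r j) + G.edist (g j) (r i) + 1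
        ≤ G.edist y (r j) + (G.edist (g j) (g i) + G.edist (g i) (r i)) + 1 := by
          gcongr; exact G.edist_triangle
      _ = G.edist (g i) (r i) + (G.edist (g j) (g i) + 1 + G.edist y (r j)) := by ring
      _ ≤ G.edist (g i) (r i) + G.edist (g j) (r j) := by gcongr

/-- A token whose target is free may be blocked on its way. The last blocking token then exchanges
targets with it: this does not increase the total distance, and it can move on. -/
theorem exists_free_move (g r : ι → V) {j : ι} (hj : r j ∉ Set.range g)
    (hfin : G.edist (g j) (r j) ≠ ⊤) :
    ∃ i, ∃ y ∉ Set.range g, G.Adj (g i) y ∧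
      ∑ k, G.edist (Function.update g i y k) (r (Equiv.swap i j k)) + 1 ≤
        ∑ k, G.edist (g k) (r k) := by
  obtain ⟨p, hp⟩ := SimpleGraph.exists_walk_of_edist_ne_top hfin
  obtain ⟨_, ⟨i, rfl⟩, y, hy, hadj, hle⟩ :=
    exists_adj_leaving_of_walk (A := Set.range g) p ⟨j, rfl⟩ hj
  exact ⟨i, y, hy, hadj, sum_update_swap_edist_le g r i j y (hle.trans_eq hp)⟩

theorem image_update_of_injective [DecidableEq V] {g : ι → V} (hg : g.Injective) (i : ι) (y : V) :
    univ.image (Function.update g i y) = insert y ((univ.image g).erase (g i)) := by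
  rw [← image_erase hg, ← insert_erase (mem_univ i), image_insert, Function.update_self,
    erase_insert_eq_erase, erase_idem]
  refine congr_arg _ (image_congr fun k hk => ?_)
  exact Function.update_of_ne (ne_of_mem_erase hk) _ _

end Tokens

theorem exists_slides_of_sum_edist_le {ι : Type*} [Fintype ι] {n : ℕ} {G : SimpleGraph (Fin n)}
    {g : ι → Fin n} (hg : g.Injective) (r : ι → Fin n) {b : ℕ} (h : ∑ k, G.edist (g k) (r k) ≤ b) :
    ∃ l ≤ b, ∃ D, Slides G l (univ.image g) D ∧ ∀ k, r k ∈ D := by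
  classical
  induction b generalizing g r with
  | zero =>
    refine ⟨0, le_rfl, _, .refl _, fun k => ?_⟩
    simp only [Nat.cast_zero, nonpos_iff_eq_zero, sum_eq_zero_iff, mem_univ, true_imp_iff,
      SimpleGraph.edist_eq_zero_iff] at h
    exact h k ▸ mem_image_of_mem g (mem_univ k)
  | succ b ih =>
    by_cases hr : ∀ k, r k ∈ univ.image g
    · exact ⟨0, b.succ.zero_le, _, .refl _, hr⟩
    obtain ⟨j, hj⟩ := not_forall.mp hr
    have hfin : G.edist (g j) (r j) ≠ ⊤ := ne_top_of_le_ne_top (ENat.natCast_ne_top _)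
      ((single_le_sum_of_canonicallyOrdered (mem_univ j)).trans h)
    obtain ⟨i, y, hy, hadj, hle⟩ := exists_free_move g r (by simpa using hj) hfin
    obtain ⟨l, hl, D, hD, hrD⟩ := ih (injective_update_of_notMem hg hy) (r ∘ Equiv.swap i j)
      ((ENat.add_le_add_iff_right ENat.one_ne_top).mp (hle.trans h))
    exact ⟨l + 1, by omega, D, .step ⟨g i, by simp, y, by simpa using hy, hadj.symm,
      image_update_of_injective hg i y⟩ hD, fun k => by simpa using hrD (Equiv.swap i j k)⟩

theorem Instance.isYes_iff_exists_assignment {I : Instance} :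
    I.IsYes ↔ ∃ f : Fin I.n → Fin I.n, IsDominatingSet I.G (I.S.image f) ∧
      ∑ s ∈ I.S, I.G.edist s (f s) ≤ I.b := by
  rw [isYes_iff_exists_slides]
  constructor
  · rintro ⟨l, hl, D, hslides, hD⟩
    obtain ⟨f, rfl, hf⟩ := hslides.exists_image_eq
    exact ⟨f, hD, hf.trans (by exact_mod_cast hl)⟩
  · rintro ⟨f, hD, hf⟩
    rw [← sum_coe_sort] at hf
    obtain ⟨l, hl, D, hslides, hfD⟩ :=
      exists_slides_of_sum_edist_le Subtype.val_injective (fun s : I.S => f s) hf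
    rw [univ_eq_attach, attach_image_val] at hslides
    exact ⟨l, hl, D, hslides, hD.mono (image_subset_iff.mpr fun s hs => hfD ⟨s, hs⟩)⟩

/-! ## The kernel -/

namespace Instance

/-- The subinstance induced on the vertex set `K`, with budget `b`. -/
noncomputable def restrict (I : Instance) (K : Finset (Fin I.n)) (b : ℕ) : Instance where
  n := #K
  G := I.G.comap (K.orderEmbOfFin rfl)
  S := I.S.preimage (K.orderEmbOfFin rfl) (K.orderEmbOfFin rfl).injective.injOn
  b := b

/-- The inclusion of the vertices of `I.restrict K b` into those of `I`. -/
noncomputable def inclusion (I : Instance) (K : Finset (Fin I.n)) (b : ℕ) :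
    Fin (I.restrict K b).n ↪o Fin I.n :=
  K.orderEmbOfFin rfl

variable {I : Instance} {K C : Finset (Fin I.n)} {b d : ℕ}

theorem mem_restrict_S {v : Fin (I.restrict K b).n} :
    v ∈ (I.restrict K b).S ↔ I.inclusion K b v ∈ I.S :=
  mem_preimage (hf := (I.inclusion K b).injective.injOn)

theorem range_inclusion (I : Instance) (K : Finset (Fin I.n)) (b : ℕ) :
    Set.range (I.inclusion K b) = K :=
  range_orderEmbOfFin K rfl

theorem exists_inclusion_eq {v : Fin I.n} (hv : v ∈ K) : ∃ i, I.inclusion K b i = v := by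
  rwa [← Set.mem_range, range_inclusion, mem_coe]

theorem restrict_isIndContained (I : Instance) (K : Finset (Fin I.n)) (b : ℕ) :
    (I.restrict K b).G.IsIndContained I.G :=
  ⟨⟨(I.inclusion K b).toEmbedding, Iff.rfl⟩⟩

theorem map_restrict_S (hK : I.S ⊆ K) :
    (I.restrict K b).S.map (I.inclusion K b).toEmbedding = I.S := by
  ext v
  simp only [mem_map, mem_restrict_S]
  constructor
  · rintro ⟨i, hi, rfl⟩
    exact hi
  · intro hv
    obtain ⟨i, rfl⟩ := exists_inclusion_eq (b := b) (hK hv)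
    exact ⟨i, hv, rfl⟩

theorem tokens_restrict (hK : I.S ⊆ K) : (I.restrict K b).tokens = I.tokens := by
  simpa only [card_map, tokens] using congr_arg card (map_restrict_S (b := b) hK)

theorem sum_restrict_S (hK : I.S ⊆ K) (F : Fin I.n → ℕ∞) :
    ∑ i ∈ (I.restrict K b).S, F (I.inclusion K b i) = ∑ s ∈ I.S, F s := by
  rw [← map_restrict_S (b := b) hK, sum_map]
  rfl

/-- Both sides say that the core `C` is dominated. -/
theorem isDominatingSet_restrict_iff (hC : IsCore I.G d I.tokens C)
    (hG : (completeBipartiteGraph (Fin d) (Fin d)).Free I.G) (hCK : C ⊆ K) (hSK : I.S ⊆ K)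
    {f' : Fin (I.restrict K b).n → Fin (I.restrict K b).n} {f : Fin I.n → Fin I.n}
    (hf : ∀ i ∈ (I.restrict K b).S, I.inclusion K b (f' i) = f (I.inclusion K b i)) :
    IsDominatingSet (I.restrict K b).G ((I.restrict K b).S.image f') ↔
      IsDominatingSet I.G (I.S.image f) := by
  have himage : I.S.image f = ((I.restrict K b).S.image f').image (I.inclusion K b) := by
    rw [image_image, ← map_restrict_S (b := b) hSK, map_eq_image, image_image]
    exact (image_congr hf).symm
  have hadj : ∀ u v, ClosedAdj (I.restrict K b).G u v ↔
      ClosedAdj I.G (I.inclusion K b u) (I.inclusion K b v) := fun u v =>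
    or_congr (I.inclusion K b).eq_iff_eq.symm Iff.rfl
  simp only [isDominatingSet_iff, hadj]
  refine ⟨fun h => hC.dominates hG card_image_le fun c hc => ?_, fun h v => ?_⟩
  · obtain ⟨i, rfl⟩ := exists_inclusion_eq (b := b) (hCK hc)
    simpa [himage] using h i
  · simpa [himage] using h (I.inclusion K b v)

theorem isYes_of_isYes_restrict (hC : IsCore I.G d I.tokens C)
    (hG : (completeBipartiteGraph (Fin d) (Fin d)).Free I.G) (hCK : C ⊆ K) (hSK : I.S ⊆ K)
    (h : (I.restrict K b).IsYes) (hb : b ≤ I.b) : I.IsYes := by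
  rw [isYes_iff_exists_assignment] at h ⊢
  obtain ⟨f', hf', hsum⟩ := h
  set e := I.inclusion K b
  have hf : ∀ i, Function.extend e (e ∘ f') id (e i) = e (f' i) :=
    e.injective.extend_apply _ _
  refine ⟨_, (isDominatingSet_restrict_iff hC hG hCK hSK fun i _ => (hf i).symm).mp hf', ?_⟩
  calc ∑ s ∈ I.S, I.G.edist s (Function.extend e (e ∘ f') id s)
      = ∑ i ∈ (I.restrict K b).S, I.G.edist (e i) (e (f' i)) := by
        rw [← sum_restrict_S (b := b) hSK]
        exact sum_congr rfl fun i _ => by rw [← hf]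
    _ ≤ ∑ i ∈ (I.restrict K b).S, (I.restrict K b).G.edist i (f' i) :=
        sum_le_sum fun i _ => edist_le_edist_comap e i (f' i)
    _ ≤ I.b := hsum.trans (by exact_mod_cast hb)

/-- Sending each token to the representative of its target costs no more and still dominates the
core, hence the graph. -/
theorem exists_representative_assignment (hC : IsCore I.G d I.tokens C)
    (hG : (completeBipartiteGraph (Fin d) (Fin d)).Free I.G) {f : Fin I.n → Fin I.n}
    (hf : IsDominatingSet I.G (I.S.image f)) (hsum : ∑ s ∈ I.S, I.G.edist s (f s) ≠ ⊤) :
    ∃ g : Fin I.n → Fin I.n, (∀ s ∈ I.S, IsRepresentative I.G I.S C s (g s)) ∧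
      IsDominatingSet I.G (I.S.image g) ∧
      ∑ s ∈ I.S, I.G.edist s (g s) ≤ ∑ s ∈ I.S, I.G.edist s (f s) := by
  rw [isDominatingSet_iff] at hf
  have hdist : ∀ s ∈ I.S, I.G.edist s (f s) ≤ 3 * #I.S := fun s hs =>
    (edist_le_three_mul_card hf (ne_top_of_le_ne_top hsum
      (single_le_sum_of_canonicallyOrdered (f := fun s => I.G.edist s (f s)) hs))).trans
      (by exact_mod_cast Nat.mul_le_mul_left 3 (card_image_le (f := f)))
  choose! g hrep htrace hle using fun s hs =>
    exists_isRepresentative (C := C) hs (hdist s hs)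
  refine ⟨g, hrep, isDominatingSet_iff.mpr (hC.dominates hG card_image_le fun c hc => ?_),
    sum_le_sum hle⟩
  obtain ⟨u, hu, huc⟩ := hf c
  obtain ⟨s, hs, rfl⟩ := mem_image.mp hu
  exact ⟨g s, mem_image_of_mem g hs, (trace_eq_trace_iff.mp (htrace s hs) c hc).mpr huc⟩

theorem isYes_restrict_kernelVertices (hC : IsCore I.G d I.tokens C)
    (hG : (completeBipartiteGraph (Fin d) (Fin d)).Free I.G) (h : I.IsYes)
    (hK : K = kernelVertices I.G I.S C) :
    (I.restrict K (min I.b (3 * #I.S * #I.S))).IsYes := by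
  rw [isYes_iff_exists_assignment] at h ⊢
  obtain ⟨f, hf, hsum⟩ := h
  obtain ⟨g, hrep, hg, hle⟩ := exists_representative_assignment hC hG hf
    (ne_top_of_le_ne_top (ENat.natCast_ne_top _) hsum)
  have hCK : C ⊆ K := fun v hv => hK ▸ mem_kernelVertices.mpr (.inl hv)
  have hSK : I.S ⊆ K := fun v hv => hK ▸ mem_kernelVertices.mpr (.inr (.inl hv))
  set b := min I.b (3 * #I.S * #I.S) with hb
  set e := I.inclusion K b
  have hgeo : ∀ i ∈ (I.restrict K b).S, OnGeodesic I.G I.S C 0 (e i) (g (e i)) := fun i hi =>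
    .zero (hrep _ (mem_restrict_S.mp hi))
  have hf' : ∀ i, ∃ j, i ∈ (I.restrict K b).S → e j = g (e i) := fun i => by
    by_cases hi : i ∈ (I.restrict K b).S
    · have hmem : g (e i) ∈ K :=
        hK.ge (mem_kernelVertices.mpr (.inr (.inr ⟨0, _, hgeo i hi⟩)))
      obtain ⟨j, hj⟩ := exists_inclusion_eq hmem
      exact ⟨j, fun _ => hj⟩
    · exact ⟨i, fun h => absurd h hi⟩
  choose f' hf' using hf'
  refine ⟨f', (isDominatingSet_restrict_iff hC hG hCK hSK hf').mpr hg, ?_⟩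
  calc ∑ i ∈ (I.restrict K b).S, (I.restrict K b).G.edist i (f' i)
      ≤ ∑ i ∈ (I.restrict K b).S, I.G.edist (e i) (g (e i)) := sum_le_sum fun i hi => by
        have hgeo := hgeo i hi
        rw [← hf' i hi] at hgeo ⊢
        exact hgeo.edist_comap_le (by simp [e, range_inclusion, hK]) e.injective
    _ = ∑ s ∈ I.S, I.G.edist s (g s) := sum_restrict_S hSK fun s => I.G.edist s (g s)
    _ ≤ b := by
      have hfar : ∑ s ∈ I.S, I.G.edist s (g s) ≤ (3 * #I.S * #I.S : ℕ) :=
        (sum_le_sum fun s hs => (hrep s hs).edist_le).trans_eq (by simp [mul_comm])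
      rcases min_choice I.b (3 * #I.S * #I.S) with h | h <;> rw [hb, h]
      exacts [hle.trans hsum, hfar]

theorem isYes_restrict_kernelVertices_iff (hC : IsCore I.G d I.tokens C)
    (hG : (completeBipartiteGraph (Fin d) (Fin d)).Free I.G)
    (hK : K = kernelVertices I.G I.S C) :
    (I.restrict K (min I.b (3 * #I.S * #I.S))).IsYes ↔ I.IsYes :=
  ⟨fun h => isYes_of_isYes_restrict hC hG (fun _ hv => hK ▸ mem_kernelVertices.mpr (.inl hv))
    (fun _ hv => hK ▸ mem_kernelVertices.mpr (.inr (.inl hv))) h (min_le_left _ _),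
  fun h => isYes_restrict_kernelVertices hC hG h hK⟩

end Instance

/-! ## Total correctness with time bounds -/

/-- Started on `m`, the program `P` halts within `T` steps in a memory satisfying `Q`. -/
def Runs (P : Program) (m : Memory) (T : ℕ) (Q : Memory → Prop) : Prop :=
  ∃ t m', t ≤ T ∧ Exec P m t m' ∧ Q m'

namespace Runs

variable {P P' : Program} {e : Expr} {m : Memory} {S T : ℕ} {Q R : Memory → Prop}

theorem mono (h : Runs P m S Q) (hST : S ≤ T) (hQR : ∀ m', Q m' → R m') : Runs P m T R := by
  obtain ⟨t, m', ht, hexec, hQ⟩ := h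
  exact ⟨t, m', ht.trans hST, hexec, hQR _ hQ⟩

theorem skip (hT : 1 ≤ T) (h : Q m) : Runs .skip m T Q :=
  ⟨1, m, hT, .skip m, h⟩

theorem write {a : Expr} (hT : a.cost + e.cost + 1 ≤ T)
    (h : Q (Function.update m (a.val m) (e.val m))) : Runs (.write a e) m T Q :=
  ⟨_, _, hT, .write a e m, h⟩

theorem seq (h : Runs P m S Q) (h' : ∀ m', Q m' → Runs P' m' T R) :
    Runs (.seq P P') m (S + T) R := by
  obtain ⟨s, m₁, hs, hexec, hQ⟩ := h
  obtain ⟨t, m₂, ht, hexec', hR⟩ := h' m₁ hQ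
  exact ⟨s + t, m₂, add_le_add hs ht, .seq hexec hexec', hR⟩

theorem cond (h : e.val m ≠ 0 → Runs P m T Q) (h' : e.val m = 0 → Runs P' m T Q) :
    Runs (.cond e P P') m (e.cost + 1 + T) Q := by
  by_cases he : e.val m = 0
  · obtain ⟨t, m₁, ht, hexec, hQ⟩ := h' he
    exact ⟨_, m₁, by omega, .cond_zero he hexec, hQ⟩
  · obtain ⟨t, m₁, ht, hexec, hQ⟩ := h he
    exact ⟨_, m₁, by omega, .cond_pos he hexec, hQ⟩

theorem loop (M : ℕ) (Inv : ℕ → Memory → Prop) (h₀ : Inv 0 m)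
    (hpos : ∀ i < M, ∀ m, Inv i m → e.val m ≠ 0 ∧ Runs P m T (Inv (i + 1)))
    (hzero : ∀ m, Inv M m → e.val m = 0) :
    Runs (.loop e P) m (M * (e.cost + 1 + T) + (e.cost + 1)) (Inv M) := by
  suffices h : ∀ r i, i + r = M → ∀ m, Inv i m →
      Runs (.loop e P) m (r * (e.cost + 1 + T) + (e.cost + 1)) (Inv M) from
    h M 0 (Nat.zero_add M) m h₀
  intro r
  induction r with
  | zero =>
    rintro i rfl m hm
    exact ⟨_, m, by omega, .loop_zero (hzero m hm), hm⟩
  | succ r ih =>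
    intro i hi m hm
    obtain ⟨hne, s, m₁, hs, hexec, hInv⟩ := hpos i (by omega) m hm
    obtain ⟨t, m₂, ht, hexec', hInv'⟩ := ih (i + 1) (by omega) m₁ hInv
    refine ⟨_, m₂, ?_, .loop_pos hne hexec hexec', hInv'⟩
    rw [Nat.succ_mul]
    omega

end Runs

/-! ## A language of total functions -/

/-- The state of the tables. -/
abbrev Tables : Type := Fin 8 → ℕ → ℕ

/-- Terms over an input word `w`. With `N = w.length + 1`, summation ranges over `{0, …, N - 1}`,
and the first factor of a product is capped at `N`, so that running times are polynomial in `N`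
whatever the values of the subterms are. -/
inductive Term : Type
  | lit (c : ℕ) : Term
  | var (x : ℕ) : Term
  | inp (e : Term) : Term
  | tab (a : Fin 8) (e : Term) : Term
  | add (e₁ e₂ : Term) : Term
  | sub (e₁ e₂ : Term) : Term
  | mul (e₁ e₂ : Term) : Term
  | ite (c e₁ e₂ : Term) : Term
  | sum (x : ℕ) (e : Term) : Term

/-- The value of a term, given the input, the tables and the values of the variables. -/
def Term.eval (w : List ℕ) (τ : Tables) : Term → (ℕ → ℕ) → ℕ
  | .lit c, _ => c
  | .var x, ρ => ρ x
  | .inp e, ρ => load w (e.eval w τ ρ)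
  | .tab a e, ρ => τ a (e.eval w τ ρ)
  | .add e₁ e₂, ρ => e₁.eval w τ ρ + e₂.eval w τ ρ
  | .sub e₁ e₂, ρ => e₁.eval w τ ρ - e₂.eval w τ ρ
  | .mul e₁ e₂, ρ => min (e₁.eval w τ ρ) (w.length + 1) * e₂.eval w τ ρ
  | .ite c e₁ e₂, ρ => if c.eval w τ ρ ≠ 0 then e₁.eval w τ ρ else e₂.eval w τ ρ
  | .sum x e, ρ => ∑ i ∈ range (w.length + 1), e.eval w τ (Function.update ρ x i)

/-- Commands on tables: assignments `a[i] := e`, sequences, and loops in which a variable runs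
through `{0, …, N - 1}`. -/
inductive Cmd : Type
  | store (a : Fin 8) (i e : Term) : Cmd
  | seq (c₁ c₂ : Cmd) : Cmd
  | forN (x : ℕ) (c : Cmd) : Cmd

/-- The tables after the execution of a command. -/
def Cmd.run (w : List ℕ) : Cmd → (ℕ → ℕ) → Tables → Tables
  | .store a i e, ρ, τ =>
      Function.update τ a (Function.update (τ a) (i.eval w τ ρ) (e.eval w τ ρ))
  | .seq c₁ c₂, ρ, τ => c₂.run w ρ (c₁.run w ρ τ)
  | .forN x c, ρ, τ =>
      (List.range (w.length + 1)).foldl (fun τ i => c.run w (Function.update ρ x i) τ) τ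

/-! ## Memory layout -/

/-- The address of cell `i` of channel `c < 16`, behind an input of length `L`. -/
def addr (L c i : ℕ) : ℕ := L + (c + 1) + 16 * i

theorem addr_inj {L c c' i i' : ℕ} (hc : c < 16) (hc' : c' < 16) :
    addr L c i = addr L c' i' ↔ c = c' ∧ i = i' := by
  unfold addr; omega

theorem lt_addr (L c i : ℕ) : L < addr L c i := by unfold addr; omega

/-- What the program of a term or command keeps in memory besides the input. -/
@[ext]
structure State : Type where
  /-- the values of the variables (channel `0`) -/
  var : ℕ → ℕ
  /-- a stack of temporary values (channel `1`) -/
  tmp : ℕ → ℕ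
  /-- the tables (channels `2, …, 9`) -/
  tab : Tables

namespace State

/-- Assign a value to a variable. -/
@[simps]
def setVar (s : State) (x v : ℕ) : State := { s with var := Function.update s.var x v }

/-- Assign a value to a cell of the stack. -/
@[simps]
def setTmp (s : State) (h v : ℕ) : State := { s with tmp := Function.update s.tmp h v }

/-- Assign a value to a cell of a table. -/
@[simps]
def setTab (s : State) (a : Fin 8) (i v : ℕ) : State :=
  { s with tab := Function.update s.tab a (Function.update (s.tab a) i v) }

end State

/-- The memory `m` holds the input `w` and the state `s`. -/
structure Holds (w : List ℕ) (s : State) (m : Memory) : Prop where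
  inp : ∀ i ≤ w.length, m i = load w i
  var : ∀ x, m (addr w.length 0 x) = s.var x
  tmp : ∀ h, m (addr w.length 1 h) = s.tmp h
  tab : ∀ a i, m (addr w.length (a.val + 2) i) = s.tab a i

namespace Holds

variable {w : List ℕ} {s : State} {m : Memory}

theorem zero (hm : Holds w s m) : m 0 = w.length := hm.inp 0 (Nat.zero_le _)

theorem load (w : List ℕ) : Holds w ⟨0, 0, 0⟩ (load w) := by
  have hzero : ∀ c i, DSDiscovery.load w (addr w.length c i) = 0 := fun c i => by
    rw [show addr w.length c i = w.length + c + 16 * i + 1 by unfold addr; omega]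
    exact List.getD_eq_default _ _ (by omega)
  exact ⟨fun _ _ => rfl, hzero 0, hzero 1, fun a => hzero _⟩

theorem setVar (hm : Holds w s m) (x v : ℕ) :
    Holds w (s.setVar x v) (Function.update m (addr w.length 0 x) v) where
  inp j hj := by rw [Function.update_of_ne (hj.trans_lt (lt_addr _ _ _)).ne, hm.inp j hj]
  var y := by simp [Function.update_apply, addr_inj, hm.var]
  tmp h := by simp [addr_inj, hm.tmp]
  tab a j := by simp [addr_inj (show a.val + 2 < 16 by omega), hm.tab]

theorem setTmp (hm : Holds w s m) (h v : ℕ) :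
    Holds w (s.setTmp h v) (Function.update m (addr w.length 1 h) v) where
  inp j hj := by rw [Function.update_of_ne (hj.trans_lt (lt_addr _ _ _)).ne, hm.inp j hj]
  var x := by simp [addr_inj, hm.var]
  tmp j := by simp [Function.update_apply, addr_inj, hm.tmp]
  tab a j := by simp [addr_inj (show a.val + 2 < 16 by omega), hm.tab]

theorem setTab (hm : Holds w s m) (a : Fin 8) (i v : ℕ) :
    Holds w (s.setTab a i v) (Function.update m (addr w.length (a.val + 2) i) v) where
  inp j hj := by rw [Function.update_of_ne (hj.trans_lt (lt_addr _ _ _)).ne, hm.inp j hj]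
  var x := by simp [addr_inj _ (show a.val + 2 < 16 by omega), hm.var]
  tmp h := by simp [addr_inj _ (show a.val + 2 < 16 by omega), hm.tmp]
  tab a' j := by
    simp only [Function.update_apply, addr_inj (show a'.val + 2 < 16 by omega)
      (show a.val + 2 < 16 by omega), hm.tab, State.setTab_tab]
    by_cases ha : a' = a
    · subst ha
      simp [Function.update_apply]
    · simp [ha, Fin.val_inj]

end Holds

/-! ## Reading and writing the state -/

namespace Expr

/-- `2 * e` -/
def dbl (e : Expr) : Expr := e.add e

/-- The address of cell `i` of channel `c`. -/
def slot (c : ℕ) (i : Expr) : Expr :=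
  .add (.add (.read (.lit 0)) (.lit (c + 1))) i.dbl.dbl.dbl.dbl

/-- The value of the variable `x`. -/
def var (x : ℕ) : Expr := .read (slot 0 (.lit x))

/-- The contents of cell `h` of the stack. -/
def tmp (h : ℕ) : Expr := .read (slot 1 (.lit h))

/-- The contents of cell `i` of table `a`. -/
def tab (a : Fin 8) (i : Expr) : Expr := .read (slot (a.val + 2) i)

/-- The bound `N = w.length + 1`. -/
def bound : Expr := .add (.read (.lit 0)) (.lit 1)

theorem val_slot (m : Memory) (c : ℕ) (i : Expr) : (slot c i).val m = addr (m 0) c (i.val m) := by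
  simp only [slot, val, dbl, addr]; omega

@[simp] theorem cost_slot (c : ℕ) (i : Expr) : (slot c i).cost = 16 * i.cost + 20 := by
  simp only [slot, cost, dbl]; omega

@[simp] theorem cost_var (x : ℕ) : (var x).cost = 37 := rfl

@[simp] theorem cost_tmp (h : ℕ) : (tmp h).cost = 37 := rfl

@[simp] theorem cost_tab (a : Fin 8) (i : Expr) : (tab a i).cost = 16 * i.cost + 21 := by
  simp [tab, cost]

@[simp] theorem cost_bound : bound.cost = 4 := rfl

end Expr

namespace Program

/-- Write `e` into the variable `x`. -/
def setVar (x : ℕ) (e : Expr) : Program := .write (.slot 0 (.lit x)) e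

/-- Write `e` into cell `h` of the stack. -/
def setTmp (h : ℕ) (e : Expr) : Program := .write (.slot 1 (.lit h)) e

/-- Write `e` into cell `i` of table `a`. -/
def setTab (a : Fin 8) (i e : Expr) : Program := .write (.slot (a.val + 2) i) e

end Program

/-- On memories holding `w` and `s`, the expression `e` has the value `v`. -/
def HasValue (w : List ℕ) (s : State) (e : Expr) (v : ℕ) : Prop :=
  ∀ m, Holds w s m → e.val m = v

namespace HasValue

variable {w : List ℕ} {s : State} {e e₁ e₂ : Expr} {i v v₁ v₂ : ℕ}

theorem lit (c : ℕ) : HasValue w s (.lit c) c := fun _ _ => rfl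

theorem add (h₁ : HasValue w s e₁ v₁) (h₂ : HasValue w s e₂ v₂) :
    HasValue w s (.add e₁ e₂) (v₁ + v₂) :=
  fun m hm => congr_arg₂ (· + ·) (h₁ m hm) (h₂ m hm)

theorem sub (h₁ : HasValue w s e₁ v₁) (h₂ : HasValue w s e₂ v₂) :
    HasValue w s (.sub e₁ e₂) (v₁ - v₂) :=
  fun m hm => congr_arg₂ (· - ·) (h₁ m hm) (h₂ m hm)

theorem inp (h : HasValue w s e i) (hi : i ≤ w.length) : HasValue w s (.read e) (load w i) :=
  fun m hm => (congr_arg m (h m hm)).trans (hm.inp i hi)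

theorem length : HasValue w s (.read (.lit 0)) w.length := fun _ hm => hm.zero

theorem bound : HasValue w s .bound (w.length + 1) := length.add (lit 1)

theorem var (x : ℕ) : HasValue w s (.var x) (s.var x) := fun m hm => by
  rw [Expr.var, Expr.val, Expr.val_slot, hm.zero, Expr.val, hm.var]

theorem tmp (h : ℕ) : HasValue w s (.tmp h) (s.tmp h) := fun m hm => by
  rw [Expr.tmp, Expr.val, Expr.val_slot, hm.zero, Expr.val, hm.tmp]

theorem tab (a : Fin 8) (h : HasValue w s e i) : HasValue w s (.tab a e) (s.tab a i) :=
  fun m hm => by rw [Expr.tab, Expr.val, Expr.val_slot, hm.zero, h m hm, hm.tab]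

end HasValue

/-- Started on a memory that holds `w` and `s`, the program `P` halts within `T` steps in a memory
that holds `w` and some state satisfying `Q`. -/
def Computes (w : List ℕ) (P : Program) (s : State) (T : ℕ) (Q : State → Prop) : Prop :=
  ∀ m, Holds w s m → Runs P m T fun m' => ∃ s', Holds w s' m' ∧ Q s'

namespace Computes

variable {w : List ℕ} {P P' : Program} {e : Expr} {s : State} {v S T : ℕ} {Q R : State → Prop}

theorem mono (h : Computes w P s S Q) (hST : S ≤ T) (hQR : ∀ s', Q s' → R s') :
    Computes w P s T R :=
  fun m hm => (h m hm).mono hST fun _ ⟨s', hm', hQ⟩ => ⟨s', hm', hQR s' hQ⟩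

theorem skip (hT : 1 ≤ T) (h : Q s) : Computes w .skip s T Q :=
  fun _ hm => Runs.skip hT ⟨s, hm, h⟩

theorem seq (h : Computes w P s S Q) (h' : ∀ s', Q s' → Computes w P' s' T R) :
    Computes w (.seq P P') s (S + T) R :=
  fun m hm => (h m hm).seq fun m' ⟨s', hm', hQ⟩ => h' s' hQ m' hm'

theorem cond (he : HasValue w s e v) (h : v ≠ 0 → Computes w P s T Q)
    (h' : v = 0 → Computes w P' s T Q) : Computes w (.cond e P P') s (e.cost + 1 + T) Q :=
  fun m hm => Runs.cond (fun hne => h (he m hm ▸ hne) m hm) fun hz => h' (he m hm ▸ hz) m hm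

theorem loop (M : ℕ) (Inv : ℕ → State → Prop) {f : State → ℕ} (he : ∀ s, HasValue w s e (f s))
    (h₀ : Inv 0 s) (hpos : ∀ i < M, ∀ s, Inv i s → f s ≠ 0 ∧ Computes w P s T (Inv (i + 1)))
    (hzero : ∀ s, Inv M s → f s = 0) :
    Computes w (.loop e P) s (M * (e.cost + 1 + T) + (e.cost + 1)) (Inv M) := fun _ hm =>
  Runs.loop M (fun i m => ∃ s, Holds w s m ∧ Inv i s) ⟨s, hm, h₀⟩
    (fun i hi m ⟨s, hm, hs⟩ =>
      ⟨(he s m hm).trans_ne (hpos i hi s hs).1, (hpos i hi s hs).2 m hm⟩)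
    fun _ ⟨s, hm, hs⟩ => (he s _ hm).trans (hzero s hs)

theorem setVar {x : ℕ} (he : HasValue w s e v) (hT : e.cost + 37 ≤ T) (h : Q (s.setVar x v)) :
    Computes w (.setVar x e) s T Q := fun m hm =>
  Runs.write (by simp only [Expr.cost_slot, Expr.cost]; omega)
    ⟨_, by simpa only [Expr.val_slot, Expr.val, hm.zero, he m hm] using hm.setVar x v, h⟩

theorem setTmp {i : ℕ} (he : HasValue w s e v) (hT : e.cost + 37 ≤ T) (h : Q (s.setTmp i v)) :
    Computes w (.setTmp i e) s T Q := fun m hm =>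
  Runs.write (by simp only [Expr.cost_slot, Expr.cost]; omega)
    ⟨_, by simpa only [Expr.val_slot, Expr.val, hm.zero, he m hm] using hm.setTmp i v, h⟩

theorem setTab {a : Fin 8} {i : Expr} {j : ℕ} (hi : HasValue w s i j) (he : HasValue w s e v)
    (hT : 16 * i.cost + e.cost + 21 ≤ T) (h : Q (s.setTab a j v)) :
    Computes w (.setTab a i e) s T Q := fun m hm =>
  Runs.write (by simp only [Expr.cost_slot]; omega)
    ⟨_, by simpa only [Expr.val_slot, hm.zero, hi m hm, he m hm] using hm.setTab a j v, h⟩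

end Computes

/-! ## Compilation -/

/-- The state `s'` has the variables of `s`, the tables `τ`, and the first `h` cells of the stack
of `s`. -/
structure Modifies (s : State) (h : ℕ) (τ : Tables) (s' : State) : Prop where
  var : s'.var = s.var
  tab : s'.tab = τ
  tmp : ∀ i < h, s'.tmp i = s.tmp i

namespace Modifies

variable {s s' s'' : State} {h h' : ℕ} {τ τ' : Tables}

theorem trans (h₁ : Modifies s h τ s') (h₂ : Modifies s' h' τ' s'') (hh : h ≤ h') :
    Modifies s h τ' s'' :=
  ⟨h₂.var.trans h₁.var, h₂.tab, fun i hi => (h₂.tmp i (by omega)).trans (h₁.tmp i hi)⟩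

theorem setTmp {i v : ℕ} (hs : Modifies s h τ s') (hi : h ≤ i) : Modifies s h τ (s'.setTmp i v) :=
  ⟨hs.var, hs.tab, fun j hj => by
    rw [State.setTmp_tmp, Function.update_of_ne (hj.trans_le hi).ne, hs.tmp j hj]⟩

theorem refl (s : State) (h : ℕ) : Modifies s h s.tab s := ⟨rfl, rfl, fun _ _ => rfl⟩

end Modifies

namespace Program

/-- Run `P` with the variable `x` set to `0, …, N - 1`, saving `x` in cell `h` of the stack. -/
def forLoop (x h : ℕ) (P : Program) : Program :=
  .seq (.seq (.setTmp h (.var x)) (.setVar x (.lit 0)))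
    (.seq (.loop (.sub .bound (.var x)) (.seq P (.setVar x (.add (.var x) (.lit 1)))))
      (.setVar x (.tmp h)))

/-- Replace cell `h` of the stack by the minimum with `N`. -/
def capTmp (h : ℕ) : Program :=
  .cond (.sub (.tmp h) .bound) (.setTmp h .bound) .skip

/-- Write the product of the cells `h + 1` and `h + 2` of the stack into cell `h`, by repeated
addition. -/
def mulTmp (h : ℕ) : Program :=
  .seq (.setTmp h (.lit 0)) (.loop (.tmp (h + 1)) (.seq
    (.setTmp h (.add (.tmp h) (.tmp (h + 2)))) (.setTmp (h + 1) (.sub (.tmp (h + 1)) (.lit 1)))))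

end Program

namespace Computes

variable {w : List ℕ} {P : Program} {s : State} {x h T : ℕ}

theorem forLoop (J : ℕ → Tables → (ℕ → ℕ) → Prop)
    (h₀ : J 0 s.tab (Function.update s.tmp h (s.var x)))
    (hP : ∀ i ≤ w.length, ∀ s', s'.var = Function.update s.var x i → J i s'.tab s'.tmp →
      Computes w P s' T fun s'' =>
        s''.var = s'.var ∧ s''.tmp h = s'.tmp h ∧ J (i + 1) s''.tab s''.tmp) :
    Computes w (.forLoop x h P) s ((w.length + 1) * (T + 200) + 400) fun s' =>
      s'.var = s.var ∧ J (w.length + 1) s'.tab s'.tmp := by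
  let Inv (i : ℕ) (s' : State) : Prop :=
    s'.var = Function.update s.var x i ∧ s'.tmp h = s.var x ∧ J i s'.tab s'.tmp
  have hinit : Computes w (.seq (.setTmp h (.var x)) (.setVar x (.lit 0))) s (100 + 100) (Inv 0) :=
    (setTmp (.var x) (by simp) rfl).seq fun s' hs' =>
      setVar (.lit 0) (by simp [Expr.cost]) (by subst hs'; exact ⟨rfl, by simp, h₀⟩)
  have hbody : ∀ i < w.length + 1, ∀ s', Inv i s' → w.length + 1 - s'.var x ≠ 0 ∧
      Computes w (.seq P (.setVar x (.add (.var x) (.lit 1)))) s' (T + 100) (Inv (i + 1)) := by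
    rintro i hi s' ⟨hvar, htmp, hJ⟩
    refine ⟨by rw [hvar, Function.update_self]; omega, (hP i (by omega) s' hvar hJ).seq ?_⟩
    rintro s'' ⟨hvar', htmp', hJ'⟩
    have hvar'' : s''.var = Function.update s.var x i := hvar'.trans hvar
    exact setVar (.add (.var x) (.lit 1)) (by simp [Expr.cost])
      ⟨by simp [State.setVar, hvar''], htmp'.trans htmp, hJ'⟩
  have hloop := fun s' (hs' : Inv 0 s') =>
    loop (w := w) (w.length + 1) Inv (fun s => HasValue.bound.sub (.var x)) hs' hbody
      fun s'' hs'' => by simp [hs''.1]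
  refine (hinit.seq fun s₁ hs₁ => (hloop s₁ hs₁).seq fun s₂ hs₂ =>
    setVar (T := 74) (.tmp h) (by simp)
      ⟨by simp [State.setVar, hs₂.1, hs₂.2.1], hs₂.2.2⟩).mono ?_ fun _ => id
  simp only [Expr.cost, Expr.cost_bound, Expr.cost_var]
  linarith

theorem capTmp {c : ℕ} (hc : s.tmp h = c) : Computes w (.capTmp h) s 200 fun s' =>
    Modifies s h s.tab s' ∧ s'.tmp h = min c (w.length + 1) ∧ ∀ i, h < i → s'.tmp i = s.tmp i := by
  refine (cond (T := 100) ((HasValue.tmp h).sub .bound) (fun hne => ?_) fun hz => ?_).mono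
    (by simp [Expr.cost]) fun _ => id
  · refine setTmp .bound (by simp) ⟨(Modifies.refl s h).setTmp le_rfl, ?_, fun i hi => ?_⟩
    · rw [State.setTmp_tmp, Function.update_self]
      omega
    · rw [State.setTmp_tmp, Function.update_of_ne hi.ne']
  · exact skip (by omega) ⟨.refl s h, by omega, fun _ _ => rfl⟩

theorem mulTmp {c b : ℕ} (hc : s.tmp (h + 1) = c) (hb : s.tmp (h + 2) = b) :
    Computes w (.mulTmp h) s (200 + (c * 400 + 100)) fun s' =>
      Modifies s h s.tab s' ∧ s'.tmp h = c * b := by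
  let Inv (i : ℕ) (s' : State) : Prop := Modifies s h s.tab s' ∧ s'.tmp h = i * b ∧
    s'.tmp (h + 1) = c - i ∧ s'.tmp (h + 2) = b
  have hinit : Computes w (.setTmp h (.lit 0)) s 200 (Inv 0) :=
    setTmp (.lit 0) (by simp [Expr.cost])
      ⟨(Modifies.refl s h).setTmp le_rfl, by simp, by simp [hc], by simp [hb]⟩
  have hbody : ∀ i < c, ∀ s', Inv i s' → s'.tmp (h + 1) ≠ 0 ∧ Computes w
      (.seq (.setTmp h (.add (.tmp h) (.tmp (h + 2))))
        (.setTmp (h + 1) (.sub (.tmp (h + 1)) (.lit 1)))) s' (150 + 150) (Inv (i + 1)) := by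
    rintro i hi s' ⟨hs', hprod, hcount, hfactor⟩
    refine ⟨by omega, (setTmp (T := 150) ((HasValue.tmp h).add (.tmp (h + 2)))
      (by simp [Expr.cost]) rfl).seq ?_⟩
    rintro s'' rfl
    refine setTmp ((HasValue.tmp (h + 1)).sub (.lit 1)) (by simp [Expr.cost])
      ⟨(hs'.setTmp le_rfl).setTmp (Nat.le_succ h), ?_, ?_, ?_⟩
    · simp [hprod, hfactor, Nat.succ_mul]
    · simp [hcount, Nat.sub_sub]
    · simp [hfactor]
  refine hinit.seq fun s₁ hs₁ => (loop c Inv (fun s => HasValue.tmp (h + 1)) hs₁ hbody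
    fun s' hs' => by simp [hs'.2.2.1]).mono ?_ fun s' hs' => ⟨hs'.1, hs'.2.1⟩
  rw [Expr.cost_tmp]
  omega

end Computes

namespace Term

/-- The program that writes the value of a term into cell `h` of the stack, leaving the cells below
`h` unchanged. -/
def compile : Term → ℕ → Program
  | .lit c, h => .setTmp h (.lit c)
  | .var x, h => .setTmp h (.var x)
  | .inp e, h => .seq (e.compile h)
      (.cond (.sub (.tmp h) (.read (.lit 0))) (.setTmp h (.lit 0)) (.setTmp h (.read (.tmp h))))
  | .tab a e, h => .seq (e.compile h) (.setTmp h (.tab a (.tmp h)))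
  | .add e₁ e₂, h => .seq (e₁.compile h) (.seq (e₂.compile (h + 1))
      (.setTmp h (.add (.tmp h) (.tmp (h + 1)))))
  | .sub e₁ e₂, h => .seq (e₁.compile h) (.seq (e₂.compile (h + 1))
      (.setTmp h (.sub (.tmp h) (.tmp (h + 1)))))
  | .mul e₁ e₂, h => .seq (e₁.compile (h + 1)) (.seq (e₂.compile (h + 2))
      (.seq (.capTmp (h + 1)) (.mulTmp h)))
  | .ite c e₁ e₂, h => .seq (c.compile h) (.cond (.tmp h) (e₁.compile h) (e₂.compile h))
  | .sum x e, h => .seq (.setTmp h (.lit 0)) (.forLoop x (h + 1)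
      (.seq (e.compile (h + 2)) (.setTmp h (.add (.tmp h) (.tmp (h + 2))))))

open Polynomial

/-- The compiled term is evaluated within `p (w.length + 1)` steps, for every input `w`. -/
def RunsWithin (t : Term) (p : ℕ[X]) : Prop :=
  ∀ (w : List ℕ) (s : State) (h : ℕ), Computes w (t.compile h) s (p.eval (w.length + 1)) fun s' =>
    Modifies s h s.tab s' ∧ s'.tmp h = t.eval w s.tab s.var

namespace RunsWithin

variable {e c e₁ e₂ : Term} {p p₁ p₂ : ℕ[X]}

theorem lit (c : ℕ) : RunsWithin (.lit c) 100 := fun w s h => by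
  rw [eval_ofNat]
  exact .setTmp (.lit c) (by simp [Expr.cost])
    ⟨(Modifies.refl s h).setTmp le_rfl, Function.update_self ..⟩

theorem var (x : ℕ) : RunsWithin (.var x) 100 := fun w s h => by
  rw [eval_ofNat]
  exact .setTmp (.var x) (by simp) ⟨(Modifies.refl s h).setTmp le_rfl, Function.update_self ..⟩

theorem inp (he : e.RunsWithin p) : RunsWithin (.inp e) (p + 200) := fun w s h => by
  rw [eval_add, eval_ofNat]
  refine (he w s h).seq fun s₁ ⟨hs₁, hval⟩ =>
    (Computes.cond (T := 100) ((HasValue.tmp h).sub .length) (fun hne => ?_) fun hz => ?_).mono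
      (by simp [Expr.cost]) fun _ => id
  · have hzero : load w (e.eval w s.tab s.var) = 0 := by
      obtain ⟨j, hj⟩ := Nat.exists_eq_succ_of_ne_zero (n := e.eval w s.tab s.var) (by omega)
      rw [hj]
      exact List.getD_eq_default _ _ (by omega)
    exact .setTmp (.lit 0) (by simp [Expr.cost])
      ⟨hs₁.setTmp le_rfl, (Function.update_self ..).trans hzero.symm⟩
  · refine .setTmp (.inp (.tmp h) (by omega)) (by simp [Expr.cost]) ⟨hs₁.setTmp le_rfl, ?_⟩
    rw [State.setTmp_tmp, Function.update_self, hval, eval]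

theorem tab (a : Fin 8) (he : e.RunsWithin p) : RunsWithin (.tab a e) (p + 1000) := fun w s h => by
  rw [eval_add, eval_ofNat]
  refine (he w s h).seq fun s₁ ⟨hs₁, hval⟩ =>
    .setTmp (.tab a (.tmp h)) (by simp) ⟨hs₁.setTmp le_rfl, ?_⟩
  rw [State.setTmp_tmp, Function.update_self, hval, hs₁.tab, eval]

theorem seq_compile (h₁ : e₁.RunsWithin p₁) (h₂ : e₂.RunsWithin p₂) {w : List ℕ} {s : State}
    {P : Program} {h i j T : ℕ} {Q : State → Prop} (hi : h ≤ i) (hj : i < j)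
    (hP : ∀ s', Modifies s h s.tab s' → s'.tmp i = e₁.eval w s.tab s.var →
      s'.tmp j = e₂.eval w s.tab s.var → Computes w P s' T Q) :
    Computes w (.seq (e₁.compile i) (.seq (e₂.compile j) P)) s
      (p₁.eval (w.length + 1) + (p₂.eval (w.length + 1) + T)) Q :=
  (h₁ w s i).seq fun s₁ ⟨hs₁, hval₁⟩ => (h₂ w s₁ j).seq fun s₂ ⟨hs₂, hval₂⟩ =>
    hP s₂ (((Modifies.refl s h).trans hs₁ hi).trans (hs₁.tab ▸ hs₂) (by omega))
      ((hs₂.tmp i hj).trans hval₁) (by rw [hval₂, hs₁.tab, hs₁.var])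

theorem add (h₁ : e₁.RunsWithin p₁) (h₂ : e₂.RunsWithin p₂) :
    RunsWithin (.add e₁ e₂) (p₁ + (p₂ + 200)) := fun w s h => by
  rw [eval_add, eval_add, eval_ofNat]
  refine seq_compile h₁ h₂ le_rfl (Nat.lt_succ_self h) fun s' hs' hval₁ hval₂ =>
    .setTmp ((HasValue.tmp h).add (.tmp (h + 1))) (by simp [Expr.cost]) ⟨hs'.setTmp le_rfl, ?_⟩
  rw [State.setTmp_tmp, Function.update_self, hval₁, hval₂, eval]

theorem sub (h₁ : e₁.RunsWithin p₁) (h₂ : e₂.RunsWithin p₂) :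
    RunsWithin (.sub e₁ e₂) (p₁ + (p₂ + 200)) := fun w s h => by
  rw [eval_add, eval_add, eval_ofNat]
  refine seq_compile h₁ h₂ le_rfl (Nat.lt_succ_self h) fun s' hs' hval₁ hval₂ =>
    .setTmp ((HasValue.tmp h).sub (.tmp (h + 1))) (by simp [Expr.cost]) ⟨hs'.setTmp le_rfl, ?_⟩
  rw [State.setTmp_tmp, Function.update_self, hval₁, hval₂, eval]

theorem mul (h₁ : e₁.RunsWithin p₁) (h₂ : e₂.RunsWithin p₂) :
    RunsWithin (.mul e₁ e₂) (p₁ + (p₂ + (200 + (200 + (X * 400 + 100))))) := fun w s h => by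
  simp only [eval_add, eval_ofNat, eval_mul, eval_X]
  refine seq_compile h₁ h₂ (Nat.le_succ h) (Nat.lt_succ_self _) fun s' hs' hval₁ hval₂ =>
    (Computes.capTmp hval₁).seq fun s₁ ⟨hs₁, hcap, hkeep⟩ =>
    (Computes.mulTmp hcap ((hkeep _ (Nat.lt_succ_self _)).trans hval₂)).mono
      (by gcongr; exact min_le_right _ _)
      fun s₂ ⟨hs₂, hprod⟩ => ⟨?_, hprod⟩
  have hs₁' := hs'.trans hs₁ (Nat.le_succ h)
  rw [hs'.tab] at hs₁'
  rw [hs₁'.tab] at hs₂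
  exact hs₁'.trans hs₂ le_rfl

theorem ite (hc : c.RunsWithin p) (h₁ : e₁.RunsWithin p₁) (h₂ : e₂.RunsWithin p₂) :
    RunsWithin (.ite c e₁ e₂) (p + (38 + (p₁ + p₂))) := fun w s h => by
  simp only [eval_add, eval_ofNat]
  refine (hc w s h).seq fun s₁ ⟨hs₁, hval⟩ => Computes.cond (.tmp h) (fun hne => ?_) fun hz => ?_
  · refine (h₁ w s₁ h).mono (Nat.le_add_right _ _) fun s₂ ⟨hs₂, hval'⟩ =>
      ⟨hs₁.trans (hs₁.tab ▸ hs₂) le_rfl, ?_⟩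
    rw [hval', hs₁.tab, hs₁.var, eval, if_pos (hval ▸ hne)]
  · refine (h₂ w s₁ h).mono (Nat.le_add_left _ _) fun s₂ ⟨hs₂, hval'⟩ =>
      ⟨hs₁.trans (hs₁.tab ▸ hs₂) le_rfl, ?_⟩
    rw [hval', hs₁.tab, hs₁.var, eval, if_neg (not_not.mpr (hval ▸ hz))]

theorem sum (x : ℕ) (he : e.RunsWithin p) :
    RunsWithin (.sum x e) (100 + (X * ((p + 200) + 200) + 400)) := fun w s h => by
  simp only [eval_add, eval_ofNat, eval_mul, eval_X]
  refine (Computes.setTmp (.lit 0) (by simp [Expr.cost]) rfl).seq ?_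
  rintro s₁ rfl
  let J (i : ℕ) (τ : Tables) (θ : ℕ → ℕ) : Prop := τ = s.tab ∧ (∀ j < h, θ j = s.tmp j) ∧
    θ h = ∑ j ∈ range i, e.eval w s.tab (Function.update s.var x j)
  suffices hloop : ∀ i ≤ w.length, ∀ s', s'.var = Function.update s.var x i →
      J i s'.tab s'.tmp → Computes w (.seq (e.compile (h + 2))
        (.setTmp h (.add (.tmp h) (.tmp (h + 2))))) s' (p.eval (w.length + 1) + 200) fun s'' =>
          s''.var = s'.var ∧ s''.tmp (h + 1) = s'.tmp (h + 1) ∧ J (i + 1) s''.tab s''.tmp by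
    have hinit : J 0 s.tab (Function.update (Function.update s.tmp h 0) (h + 1) (s.var x)) :=
      ⟨rfl, fun j hj => by simp [hj.ne, (hj.trans (Nat.lt_succ_self h)).ne], by simp⟩
    exact (Computes.forLoop (s := s.setTmp h 0) J hinit hloop).mono le_rfl
      fun s' ⟨hvar, htab, htmp, hsum⟩ => ⟨⟨hvar, htab, htmp⟩, hsum⟩
  rintro i - s' hvar ⟨htab, htmp, hsum⟩
  refine (he w s' (h + 2)).seq fun s'' ⟨hs'', hval⟩ =>
    .setTmp ((HasValue.tmp h).add (.tmp (h + 2))) (by simp [Expr.cost])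
      ⟨hs''.var, ?_, hs''.tab.trans htab, fun j hj => ?_, ?_⟩
  · simp [hs''.tmp]
  · simp [hj.ne, hs''.tmp j (by omega), htmp j hj]
  · simp [hval, hs''.tmp h (by omega), hsum, hvar, htab, sum_range_succ]

end RunsWithin

theorem exists_runsWithin (t : Term) : ∃ p, t.RunsWithin p := by
  induction t with
  | lit c => exact ⟨_, .lit c⟩
  | var x => exact ⟨_, .var x⟩
  | inp e ih => exact ih.imp' _ fun _ => .inp
  | tab a e ih => exact ih.imp' _ fun _ => .tab a
  | add e₁ e₂ ih₁ ih₂ => obtain ⟨p₁, h₁⟩ := ih₁; exact ih₂.imp' _ fun _ => h₁.add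
  | sub e₁ e₂ ih₁ ih₂ => obtain ⟨p₁, h₁⟩ := ih₁; exact ih₂.imp' _ fun _ => h₁.sub
  | mul e₁ e₂ ih₁ ih₂ => obtain ⟨p₁, h₁⟩ := ih₁; exact ih₂.imp' _ fun _ => h₁.mul
  | ite c e₁ e₂ ih ih₁ ih₂ =>
    obtain ⟨p, hc⟩ := ih
    obtain ⟨p₁, h₁⟩ := ih₁
    exact ih₂.imp' _ fun _ => hc.ite h₁
  | sum x e ih => exact ih.imp' _ fun _ => .sum x

end Term

namespace Cmd

/-- The program that executes a command, using only the cells of the stack from `h` on. -/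
def compile : Cmd → ℕ → Program
  | .store a i e, h => .seq (i.compile h) (.seq (e.compile (h + 1))
      (.setTab a (.tmp h) (.tmp (h + 1))))
  | .seq c₁ c₂, h => .seq (c₁.compile h) (c₂.compile h)
  | .forN x c, h => .forLoop x h (c.compile (h + 1))

open Polynomial

/-- The compiled command is executed within `p (w.length + 1)` steps, for every input `w`. -/
def RunsWithin (c : Cmd) (p : ℕ[X]) : Prop :=
  ∀ (w : List ℕ) (s : State) (h : ℕ), Computes w (c.compile h) s (p.eval (w.length + 1))
    (Modifies s h (c.run w s.var s.tab))

namespace RunsWithin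

variable {c c₁ c₂ : Cmd} {p p₁ p₂ : ℕ[X]}

theorem store (a : Fin 8) {i e : Term} (h₁ : i.RunsWithin p₁) (h₂ : e.RunsWithin p₂) :
    RunsWithin (.store a i e) (p₁ + (p₂ + 1000)) := fun w s h => by
  rw [eval_add, eval_add, eval_ofNat]
  exact h₁.seq_compile h₂ le_rfl (Nat.lt_succ_self h) fun s' hs' hval₁ hval₂ =>
    .setTab (.tmp h) (.tmp (h + 1)) (by simp)
      ⟨hs'.var, by simp only [State.setTab, hs'.tab, hval₁, hval₂, run], hs'.tmp⟩

theorem seq (h₁ : c₁.RunsWithin p₁) (h₂ : c₂.RunsWithin p₂) :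
    RunsWithin (.seq c₁ c₂) (p₁ + p₂) := fun w s h => by
  rw [eval_add]
  refine (h₁ w s h).seq fun s₁ hs₁ => (h₂ w s₁ h).mono le_rfl fun s₂ hs₂ => ?_
  rw [hs₁.var, hs₁.tab] at hs₂
  exact hs₁.trans hs₂ le_rfl

theorem forN (x : ℕ) (hc : c.RunsWithin p) :
    RunsWithin (.forN x c) (X * (p + 200) + 400) := fun w s h => by
  simp only [eval_add, eval_ofNat, eval_mul, eval_X]
  let J (i : ℕ) (τ : Tables) (θ : ℕ → ℕ) : Prop :=
    τ = (List.range i).foldl (fun τ i => c.run w (Function.update s.var x i) τ) s.tab ∧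
      ∀ j < h, θ j = s.tmp j
  refine (Computes.forLoop J ⟨rfl, fun j hj => Function.update_of_ne hj.ne _ _⟩ ?_).mono le_rfl
    fun s' ⟨hvar, htab, htmp⟩ => ⟨hvar, htab, htmp⟩
  rintro i - s' hvar ⟨htab, htmp⟩
  refine (hc w s' (h + 1)).mono le_rfl fun s'' hs'' => ⟨hs''.var, hs''.tmp h (Nat.lt_succ_self h),
    ?_, fun j hj => (hs''.tmp j (by omega)).trans (htmp j hj)⟩
  rw [hs''.tab, hvar, htab, List.range_succ, List.foldl_append, List.foldl_cons, List.foldl_nil]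

end RunsWithin

theorem exists_runsWithin (c : Cmd) : ∃ p, c.RunsWithin p := by
  induction c with
  | store a i e =>
    obtain ⟨p₁, h₁⟩ := i.exists_runsWithin
    exact e.exists_runsWithin.imp' _ fun _ => .store a h₁
  | seq c₁ c₂ ih₁ ih₂ => obtain ⟨p₁, h₁⟩ := ih₁; exact ih₂.imp' _ fun _ => h₁.seq
  | forN x c ih => exact ih.imp' _ fun _ => .forN x

end Cmd

namespace Program

/-- Copy cell `i` of table `a` to cell `i` of the memory, where `i` is the value of variable `0`,
and increment `i`. -/
def copyCell (a : Fin 8) : Program :=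
  .seq (.write (.var 0) (.tab a (.var 0))) (.setVar 0 (.add (.var 0) (.lit 1)))

/-- Copy the cells `0, …, w.length` of table `a` to the output. Cell `0` comes last, because the
addresses of all other cells depend on its contents. -/
def copyOut (a : Fin 8) : Program :=
  .seq (.setVar 0 (.lit 1)) (.seq (.loop (.sub .bound (.var 0)) (copyCell a))
    (.write (.lit 0) (.tab a (.lit 0))))

end Program

/-- The cells `1, …, i` of a table with contents `T` have been copied to the output; the table is
stored in channel `a + 2` behind an input of length `L`, and the next cell to copy is in
variable `0`. -/
structure Copied (L : ℕ) (a : Fin 8) (T : ℕ → ℕ) (i : ℕ) (m : Memory) : Prop where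
  zero : m 0 = L
  var : m (addr L 0 0) = i + 1
  tab : ∀ j, m (addr L (a.val + 2) j) = T j
  out : ∀ j, 1 ≤ j → j ≤ i → m j = T j

namespace Copied

variable {L i : ℕ} {a : Fin 8} {T : ℕ → ℕ} {m : Memory}

theorem val_var (hm : Copied L a T i m) : (Expr.var 0).val m = i + 1 := by
  rw [Expr.var, Expr.val, Expr.val_slot, hm.zero, Expr.val, hm.var]

theorem val_tab (hm : Copied L a T i m) (e : Expr) : (Expr.tab a e).val m = T (e.val m) := by
  rw [Expr.tab, Expr.val, Expr.val_slot, hm.zero, hm.tab]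

theorem runs_copyCell (hi : i < L) (hm : Copied L a T i m) :
    Runs (.copyCell a) m (1000 + 1000) (Copied L a T (i + 1)) := by
  have haddr : ∀ c j, addr L c j ≠ i + 1 := fun c j => (by omega : i + 1 < L + 1).trans_le
    (lt_addr L c j) |>.ne'
  refine Runs.seq (Q := (· = Function.update m (i + 1) (T (i + 1)))) (Runs.write
    (by simp) (by rw [hm.val_tab, hm.val_var])) ?_
  rintro _ rfl
  set m₁ := Function.update m (i + 1) (T (i + 1)) with hm₁
  have hzero : m₁ 0 = L := by rw [hm₁, Function.update_of_ne (by omega), hm.zero]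
  have hvar : m₁ (addr L 0 0) = i + 1 := by rw [hm₁, Function.update_of_ne (haddr _ _), hm.var]
  refine Runs.write (by simp [Expr.cost]) ?_
  simp only [Expr.val, Expr.val_slot, Expr.var, hzero, hvar]
  refine ⟨?_, Function.update_self .., fun j => ?_, fun j hj hji => ?_⟩
  · rw [Function.update_of_ne (by have := lt_addr L 0 0; omega), hzero]
  · rw [Function.update_of_ne (by simp [addr_inj (show a.val + 2 < 16 by omega)]), hm₁,
      Function.update_of_ne (haddr _ _), hm.tab]
  · rw [Function.update_of_ne (by have := lt_addr L 0 0; omega), hm₁, Function.update_apply]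
    split_ifs with h
    · rw [h]
    · exact hm.out j hj (by omega)

end Copied

theorem Holds.runs_copyOut {w : List ℕ} {s : State} {m : Memory} (hm : Holds w s m) (a : Fin 8) :
    Runs (.copyOut a) m (w.length * 3000 + 3000) fun m' => ∀ i ≤ w.length, m' i = s.tab a i := by
  have hinit : Runs (.setVar 0 (.lit 1)) m 1000 (Copied w.length a (s.tab a) 0) := by
    refine Runs.write (by simp [Expr.cost]) ?_
    rw [Expr.val_slot, hm.zero]
    have hm' := hm.setVar 0 1
    exact ⟨hm'.zero, hm'.var 0, hm'.tab a, fun j hj hj' => by omega⟩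
  refine (hinit.seq fun m₁ hm₁ => (Runs.loop w.length (Copied w.length a (s.tab a)) hm₁
    (fun i hi m hm => ⟨?_, hm.runs_copyCell hi⟩) fun m hm => ?_).seq
    fun m₂ hm₂ => Runs.write (T := 1000) ?_ fun j hj => ?_).mono ?_ fun _ => id
  · simp only [Expr.val, hm.val_var, Expr.bound, hm.zero]
    omega
  · simp only [Expr.val, hm.val_var, Expr.bound, hm.zero]
    omega
  · simp [Expr.cost]
  · simp only [hm₂.val_tab, Expr.val, Function.update_apply]
    split_ifs with h
    · rw [h]
    · exact hm₂.out j (by omega) hj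
  · simp only [Expr.cost, Expr.cost_bound, Expr.cost_var]
    linarith

theorem length_le_wordSize (w : List ℕ) : w.length ≤ wordSize w := by
  induction w with
  | nil => simp
  | cons a w ih => simp only [wordSize, List.map_cons, List.sum_cons, List.length_cons] at *; omega

theorem polynomial_eval_mono (p : Polynomial ℕ) : Monotone fun a => p.eval a := fun a b h => by
  simp only [Polynomial.eval_eq_sum]
  exact sum_le_sum fun i _ => Nat.mul_le_mul_left _ (Nat.pow_le_pow_left h i)

open Polynomial in
theorem Cmd.exists_program (c : Cmd) (a : Fin 8) : ∃ (P : Program) (p : ℕ[X]),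
    ∀ w v : List ℕ, v.length ≤ w.length → (∀ i ≤ v.length, c.run w 0 0 a i = load v i) →
      OutputsWithin P w v (p.eval (wordSize w)) := by
  obtain ⟨p, hp⟩ := c.exists_runsWithin
  refine ⟨.seq (c.compile 0) (.copyOut a), p.comp (X + 1) + (X * 3000 + 3000),
    fun w v hvw hv => ?_⟩
  obtain ⟨t, m', ht, hexec, hout⟩ := (hp w _ 0 _ (Holds.load w)).seq
    fun m₁ ⟨s, hm₁, hs⟩ => hs.tab ▸ hm₁.runs_copyOut a
  refine ⟨t, m', ht.trans ?_, hexec, fun i hi => by rw [hout i (hi.trans hvw), hv i hi]⟩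
  simp only [eval_add, eval_comp, eval_mul, eval_X, eval_one, eval_ofNat]
  have hlen := length_le_wordSize w
  gcongr
  exact polynomial_eval_mono p (by omega)

/-! ## Filling tables -/

theorem foldl_range_mul {α : Type*} (M K : ℕ) (f : α → ℕ → α) (s : α) :
    (List.range (M * K)).foldl f s =
      (List.range M).foldl (fun s i => (List.range K).foldl (fun s j => f s (i * K + j)) s) s := by
  induction M with
  | zero => simp
  | succ M ih =>
    rw [Nat.succ_mul, List.range_add, List.foldl_append, ih, List.range_succ, List.foldl_append,
      List.foldl_map]
    rfl

/-- The tables after the assignments `a[p] := F p` for `p = 0, …, M - 1`, where `F p` depends on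
the tables at the time of the assignment. -/
def storeRange (a : Fin 8) (F : ℕ → Tables → ℕ) (M : ℕ) (τ : Tables) : Tables :=
  (List.range M).foldl (fun τ p => Function.update τ a (Function.update (τ a) p (F p τ))) τ

section StoreRange

variable (a : Fin 8) (F : ℕ → Tables → ℕ)

theorem storeRange_succ (M : ℕ) (τ : Tables) :
    storeRange a F (M + 1) τ = Function.update (storeRange a F M τ) a
      (Function.update (storeRange a F M τ a) M (F M (storeRange a F M τ))) := by
  rw [storeRange, List.range_succ, List.foldl_append]
  rfl

theorem storeRange_of_ne {a' : Fin 8} (h : a' ≠ a) (M : ℕ) (τ : Tables) :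
    storeRange a F M τ a' = τ a' := by
  induction M with
  | zero => rfl
  | succ M ih => rw [storeRange_succ, Function.update_of_ne h, ih]

theorem storeRange_apply_of_le {q M K : ℕ} (hq : q < M) (h : M ≤ K) (τ : Tables) :
    storeRange a F K τ a q = storeRange a F M τ a q := by
  induction K, h using Nat.le_induction with
  | base => rfl
  | succ K hMK ih =>
    rw [storeRange_succ, Function.update_self, Function.update_of_ne (by omega), ih]

theorem storeRange_apply {q M : ℕ} (hq : q < M) (τ : Tables) :
    storeRange a F M τ a q = F q (storeRange a F q τ) := by
  rw [storeRange_apply_of_le a F (Nat.lt_succ_self q) hq, storeRange_succ, Function.update_self,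
    Function.update_self]

end StoreRange

/-- The position of the entry `(x, y, z)` in a three-dimensional table with side length `N`. -/
def index (N x y z : ℕ) : ℕ := N * (N * x + y) + z

section Index

variable {N x y z : ℕ}

theorem index_mod (hz : z < N) : index N x y z % N = z := by
  rw [index, Nat.mul_add_mod, Nat.mod_eq_of_lt hz]

theorem index_div (hz : z < N) : index N x y z / N = N * x + y := by
  rw [index, Nat.mul_add_div (Nat.zero_lt_of_lt hz), Nat.div_eq_of_lt hz, add_zero]

theorem index_div_mod (hy : y < N) (hz : z < N) : index N x y z / N % N = y := by
  rw [index_div hz, Nat.mul_add_mod, Nat.mod_eq_of_lt hy]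

theorem index_div_div (hy : y < N) (hz : z < N) : index N x y z / N / N = x := by
  rw [index_div hz, Nat.mul_add_div (Nat.zero_lt_of_lt hz), Nat.div_eq_of_lt hy, add_zero]

theorem index_lt_index {x' y' z' : ℕ} (hx : x < x') (hy : y < N) (hz : z < N) :
    index N x y z < index N x' y' z' := by
  have h : N * x + y + 1 ≤ N * x' + y' := by nlinarith
  calc index N x y z < N * (N * x + y) + N := by unfold index; omega
    _ = N * (N * x + y + 1) := by ring
    _ ≤ N * (N * x' + y') := Nat.mul_le_mul_left _ h
    _ ≤ index N x' y' z' := Nat.le_add_right _ _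

theorem index_lt (hx : x < N) (hy : y < N) (hz : z < N) : index N x y z < N * N * N :=
  (index_lt_index (y' := 0) (z' := 0) hx hy hz).trans_eq (by simp [index, mul_assoc])

end Index

/-- The values of the variables while the entry `(x, y, z)` of a table is being computed. -/
def env (x y z : ℕ) : ℕ → ℕ
  | 0 => x
  | 1 => y
  | 2 => z
  | _ => 0

theorem update_update_update_zero (x y z : ℕ) :
    Function.update (Function.update (Function.update (0 : ℕ → ℕ) 0 x) 1 y) 2 z = env x y z := by
  funext i
  match i with
  | 0 => rfl
  | 1 => rfl
  | 2 => rfl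
  | i + 3 => rfl

/-- The bound `N` of summations and loops. -/
def Term.bound : Term := .add (.inp (.lit 0)) (.lit 1)

/-- The position of an entry of a table with side length `N`. -/
def Term.index (e₁ e₂ e₃ : Term) : Term :=
  .add (.mul .bound (.add (.mul .bound e₁) e₂)) e₃

theorem Term.eval_index (w : List ℕ) (τ : Tables) (ρ : ℕ → ℕ) (e₁ e₂ e₃ : Term) :
    (Term.index e₁ e₂ e₃).eval w τ ρ =
      DSDiscovery.index (w.length + 1) (e₁.eval w τ ρ) (e₂.eval w τ ρ) (e₃.eval w τ ρ) := by
  have hbound : Term.bound.eval w τ ρ = w.length + 1 := rfl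
  simp only [Term.index, Term.eval, hbound, min_self, DSDiscovery.index]

/-- Set the entries `(x, y, z)` of table `a` with `x, y, z < N` to the value of `t`, in
lexicographic order. The term finds `x`, `y` and `z` in the variables `0`, `1` and `2`. -/
def Cmd.fill (a : Fin 8) (t : Term) : Cmd :=
  .forN 0 (.forN 1 (.forN 2 (.store a (.index (.var 0) (.var 1) (.var 2)) t)))

theorem Cmd.run_fill (w : List ℕ) (a : Fin 8) (t : Term) (τ : Tables) :
    let N := w.length + 1
    (Cmd.fill a t).run w 0 τ =
      storeRange a (fun p σ => t.eval w σ (env (p / N / N) (p / N % N) (p % N))) (N * N * N) τ := by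
  intro N
  rw [storeRange, foldl_range_mul, foldl_range_mul]
  refine List.foldl_ext _ _ _ fun τ₁ x hx => List.foldl_ext _ _ _ fun τ₂ y hy =>
    List.foldl_ext _ _ _ fun τ₃ z hz => ?_
  rw [List.mem_range] at hx hy hz
  have hindex : (x * N + y) * N + z = index N x y z := by rw [index]; ring
  rw [hindex, index_div_div hy hz, index_div_mod hy hz, index_mod hz, update_update_update_zero,
    Cmd.run, Term.eval_index]
  rfl

/-! ## The encoding of an instance -/

theorem length_flatMap_const {α : Type*} {m : ℕ} {g : α → List ℕ} (hg : ∀ a, (g a).length = m)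
    (l : List α) : (l.flatMap g).length = l.length * m := by
  simp [List.length_flatMap, hg]

theorem getD_flatMap_append {α : Type*} {m : ℕ} {g : α → List ℕ} (hg : ∀ a, (g a).length = m)
    (l : List α) (s : List ℕ) (i j : ℕ) (hi : i < l.length) (hj : j < m) :
    (l.flatMap g ++ s).getD (i * m + j) 0 = (g l[i]).getD j 0 := by
  induction l generalizing i with
  | nil => simp at hi
  | cons a l ih =>
    rw [List.flatMap_cons, List.append_assoc]
    cases i with
    | zero =>
      rw [List.getD_append _ _ _ _ (by rw [hg]; omega)]
      simp
    | succ i =>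
      have hshift : (i + 1) * m + j = (g a).length + (i * m + j) := by rw [hg]; ring
      rw [hshift, List.getD_append_right _ _ _ _ (by omega), Nat.add_sub_cancel_left,
        ih i (by simpa using hi)]
      simp

namespace Instance

variable (I : Instance)

theorem length_encode : I.encode.length = I.n * I.n + I.n + 2 := by
  simp only [encode, List.length_cons, List.length_append, List.length_map, List.length_finRange]
  rw [length_flatMap_const (m := I.n) (fun _ => by simp), List.length_finRange]

open Classical in
theorem load_encode_adj (u v : Fin I.n) :
    load I.encode (3 + u.val * I.n + v.val) = if I.G.Adj u v then 1 else 0 := by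
  rw [show 3 + u.val * I.n + v.val = u.val * I.n + v.val + 1 + 1 + 1 by omega]
  simp only [load, encode, List.getD_cons_succ]
  rw [getD_flatMap_append (m := I.n) (fun _ => by simp) _ _ _ _ (by simp) v.isLt]
  simp

open Classical in
theorem load_encode_mem (v : Fin I.n) :
    load I.encode (3 + I.n * I.n + v.val) = if v ∈ I.S then 1 else 0 := by
  rw [show 3 + I.n * I.n + v.val = I.n * I.n + v.val + 1 + 1 + 1 by omega]
  simp only [load, encode, List.getD_cons_succ]
  rw [List.getD_append_right _ _ _ _ ?_, length_flatMap_const (m := I.n) (fun _ => by simp)]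
  · simp
  · rw [length_flatMap_const (m := I.n) (fun _ => by simp), List.length_finRange]
    exact Nat.le_add_right _ _

/-- The bound `N` of summations and loops, which is also the side length of the tables. -/
noncomputable def side : ℕ := I.encode.length + 1

theorem side_eq : I.side = I.n * I.n + I.n + 3 := by rw [side, length_encode]

theorem n_lt_side : I.n < I.side := by rw [side_eq]; nlinarith

theorem val_lt_side (v : Fin I.n) : v.val < I.side := v.isLt.trans I.n_lt_side

theorem side_pos : 0 < I.side := Nat.succ_pos _

theorem tokens_le : I.tokens ≤ I.n := card_finset_fin_le I.S

theorem three_mul_tokens_lt_side : 3 * I.tokens < I.side := by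
  have := I.tokens_le
  have := Nat.le_mul_self I.n
  have := sq_nonneg ((I.n : ℤ) - 1)
  rw [side_eq]
  nlinarith

/-- The value of a term on the input word that encodes the instance. -/
noncomputable def value (τ : Tables) (ρ : ℕ → ℕ) (t : Term) : ℕ := t.eval I.encode τ ρ

/-- A term, read as a formula, is satisfied if its value is not zero. -/
def Satisfies (τ : Tables) (ρ : ℕ → ℕ) (t : Term) : Prop := I.value τ ρ t ≠ 0

noncomputable instance (τ : Tables) (ρ : ℕ → ℕ) (t : Term) : Decidable (I.Satisfies τ ρ t) :=
  inferInstanceAs (Decidable (_ ≠ 0))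

/-- The entry `(x, y, z)` of the table `T` is not zero. -/
def Marked (T : ℕ → ℕ) (x y z : ℕ) : Prop := T (index I.side x y z) ≠ 0

end Instance

/-! ## Formulas -/

namespace Term

/-- Negation. -/
protected def not (a : Term) : Term := .sub (.lit 1) a

/-- Conjunction. -/
protected def and (a b : Term) : Term := .ite a b (.lit 0)

/-- Disjunction. -/
protected def or (a b : Term) : Term := .ite a (.lit 1) b

/-- Equivalence. -/
protected def iff (a b : Term) : Term := .ite a b b.not

/-- `a < b` -/
protected def lt (a b : Term) : Term := (Term.sub (.add a (.lit 1)) b).not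

/-- `a = b` -/
protected def eq (a b : Term) : Term := (Term.add (.sub a b) (.sub b a)).not

/-- The number of vertices of the input graph. -/
def order : Term := .inp (.lit 1)

/-- The sum over all vertices `x`; read as a formula, existential quantification. -/
def sumVertices (x : ℕ) (t : Term) : Term := .sum x (.ite ((Term.var x).lt order) t (.lit 0))

/-- The number of vertices `x` with a given property. -/
def countVertices (x : ℕ) (t : Term) : Term := sumVertices x (.ite t (.lit 1) (.lit 0))

/-- The vertices `x` and `y` are adjacent. -/
def adj (x y : ℕ) : Term := .inp (.add (.add (.lit 3) (.mul (.var x) order)) (.var y))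

/-- The vertices `x` and `y` are equal or adjacent. -/
def closedAdj (x y : ℕ) : Term := ((Term.var x).eq (.var y)).or (adj x y)

/-- There is a token on the vertex `x`. -/
def mem (x : ℕ) : Term := .inp (.add (.add (.lit 3) (.mul order order)) (.var x))

/-- The number of tokens. -/
def tokens : Term := countVertices 6 (mem 6)

/-- An entry of the table `a`. -/
def entry (a : Fin 8) (e₁ e₂ e₃ : Term) : Term := .tab a (index e₁ e₂ e₃)

end Term

namespace Instance

variable (I : Instance) (τ : Tables) (ρ : ℕ → ℕ) (x : ℕ) (a b t : Term)

@[simp] theorem value_lit (c : ℕ) : I.value τ ρ (.lit c) = c := rfl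

@[simp] theorem value_var : I.value τ ρ (.var x) = ρ x := rfl

@[simp] theorem value_inp : I.value τ ρ (.inp a) = load I.encode (I.value τ ρ a) := rfl

@[simp] theorem value_add : I.value τ ρ (.add a b) = I.value τ ρ a + I.value τ ρ b := rfl

@[simp] theorem value_sub : I.value τ ρ (.sub a b) = I.value τ ρ a - I.value τ ρ b := rfl

theorem value_mul {a : Term} (h : I.value τ ρ a ≤ I.side) :
    I.value τ ρ (.mul a b) = I.value τ ρ a * I.value τ ρ b :=
  congr_arg (· * I.value τ ρ b) (min_eq_left h)

@[simp] theorem value_ite (c : Term) : I.value τ ρ (.ite c a b) =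
    if I.Satisfies τ ρ c then I.value τ ρ a else I.value τ ρ b := rfl

theorem value_sum : I.value τ ρ (.sum x t) =
    ∑ i ∈ range I.side, I.value τ (Function.update ρ x i) t := rfl

theorem satisfies_sum : I.Satisfies τ ρ (.sum x t) ↔
    ∃ i < I.side, I.Satisfies τ (Function.update ρ x i) t := by
  rw [Satisfies, value_sum, Ne, sum_eq_zero_iff]
  simp [Satisfies]

theorem value_entry (i : Fin 8) (e₁ e₂ e₃ : Term) : I.value τ ρ (.entry i e₁ e₂ e₃) =
    τ i (index I.side (I.value τ ρ e₁) (I.value τ ρ e₂) (I.value τ ρ e₃)) :=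
  congr_arg (τ i) (Term.eval_index _ _ _ _ _ _)

@[simp] theorem satisfies_entry (i : Fin 8) (e₁ e₂ e₃ : Term) :
    I.Satisfies τ ρ (.entry i e₁ e₂ e₃) ↔
      I.Marked (τ i) (I.value τ ρ e₁) (I.value τ ρ e₂) (I.value τ ρ e₃) := by
  rw [Satisfies, value_entry, Marked]

@[simp] theorem satisfies_not : I.Satisfies τ ρ a.not ↔ ¬ I.Satisfies τ ρ a := by
  simp only [Satisfies, Term.not, value_sub, value_lit]; omega

@[simp] theorem satisfies_and :
    I.Satisfies τ ρ (a.and b) ↔ I.Satisfies τ ρ a ∧ I.Satisfies τ ρ b := by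
  rw [Satisfies, Term.and, value_ite]
  by_cases h : I.Satisfies τ ρ a
  · rw [if_pos h, ← Satisfies, and_iff_right h]
  · simp [h]

@[simp] theorem satisfies_or :
    I.Satisfies τ ρ (a.or b) ↔ I.Satisfies τ ρ a ∨ I.Satisfies τ ρ b := by
  rw [Satisfies, Term.or, value_ite]
  by_cases h : I.Satisfies τ ρ a
  · simp [h]
  · rw [if_neg h, ← Satisfies, or_iff_right h]

@[simp] theorem satisfies_iff :
    I.Satisfies τ ρ (a.iff b) ↔ (I.Satisfies τ ρ a ↔ I.Satisfies τ ρ b) := by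
  rw [Satisfies, Term.iff, value_ite]
  by_cases h : I.Satisfies τ ρ a
  · rw [if_pos h, ← Satisfies, iff_true_left h]
  · rw [if_neg h, ← Satisfies, satisfies_not, iff_false_left h]

@[simp] theorem satisfies_lt : I.Satisfies τ ρ (a.lt b) ↔ I.value τ ρ a < I.value τ ρ b := by
  rw [Term.lt, satisfies_not, Satisfies]; simp only [value_sub, value_add, value_lit]; omega

@[simp] theorem satisfies_eq : I.Satisfies τ ρ (a.eq b) ↔ I.value τ ρ a = I.value τ ρ b := by
  rw [Term.eq, satisfies_not, Satisfies]; simp only [value_sub, value_add]; omega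

@[simp] theorem value_order : I.value τ ρ .order = I.n := rfl

@[simp] theorem value_sumVertices : I.value τ ρ (.sumVertices x t) =
    ∑ u : Fin I.n, I.value τ (Function.update ρ x u) t := by
  have hrange : {i ∈ range I.side | i < I.n} = range I.n := by
    ext i
    have := I.n_lt_side
    simp only [mem_filter, mem_range]
    omega
  simp only [Term.sumVertices, value_sum, value_ite, satisfies_lt, value_var, Function.update_self,
    value_order, value_lit]
  rw [← sum_filter, hrange, sum_range]

@[simp] theorem satisfies_sumVertices : I.Satisfies τ ρ (.sumVertices x t) ↔
    ∃ u : Fin I.n, I.Satisfies τ (Function.update ρ x u) t := by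
  rw [Satisfies, value_sumVertices, Ne, sum_eq_zero_iff]
  simp [Satisfies]

theorem value_countVertices : I.value τ ρ (.countVertices x t) =
    #{u : Fin I.n | I.Satisfies τ (Function.update ρ x u) t} := by
  rw [card_filter, Term.countVertices, value_sumVertices]
  rfl

variable {τ ρ}

open Classical in
theorem value_adj {x y : ℕ} {u v : Fin I.n} (hx : ρ x = u) (hy : ρ y = v) :
    I.value τ ρ (.adj x y) = if I.G.Adj u v then 1 else 0 := by
  rw [← I.load_encode_adj u v, Term.adj, value_inp, value_add, value_add, I.value_mul, value_var,
    value_var, hx, hy, value_lit, value_order]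
  rw [value_var, hx]
  exact (I.val_lt_side u).le

theorem satisfies_adj {x y : ℕ} {u v : Fin I.n} (hx : ρ x = u) (hy : ρ y = v) :
    I.Satisfies τ ρ (.adj x y) ↔ I.G.Adj u v := by
  rw [Satisfies, I.value_adj hx hy]; simp

theorem satisfies_closedAdj {x y : ℕ} {u v : Fin I.n} (hx : ρ x = u) (hy : ρ y = v) :
    I.Satisfies τ ρ (.closedAdj x y) ↔ ClosedAdj I.G u v := by
  rw [Term.closedAdj, satisfies_or, satisfies_eq, I.satisfies_adj hx hy, value_var, value_var, hx,
    hy, ClosedAdj, Fin.ext_iff]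

open Classical in
theorem value_mem {x : ℕ} {u : Fin I.n} (hx : ρ x = u) :
    I.value τ ρ (.mem x) = if u ∈ I.S then 1 else 0 := by
  rw [← I.load_encode_mem u, Term.mem, value_inp, value_add, value_add,
    I.value_mul _ _ _ (a := .order) I.n_lt_side.le, value_var, hx, value_lit, value_order]

theorem satisfies_mem {x : ℕ} {u : Fin I.n} (hx : ρ x = u) :
    I.Satisfies τ ρ (.mem x) ↔ u ∈ I.S := by
  rw [Satisfies, I.value_mem hx]; simp

@[simp] theorem value_tokens : I.value τ ρ .tokens = I.tokens := by
  rw [Term.tokens, value_countVertices, tokens]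
  congr 1
  ext u
  simpa using I.satisfies_mem (u := u) (by simp)

end Instance

/-! ## Computing the core -/

/-- `Z` arises from `X` by adding at most `i` elements that satisfy `q`. -/
structure IsExtension {α : Type*} (q : α → Prop) (i : ℕ) (X Z : Finset α) : Prop where
  subset : X ⊆ Z
  prop : ∀ z ∈ Z, z ∉ X → q z
  card_le : #Z ≤ #X + i

section IsExtension

variable {α : Type*} {q : α → Prop} {i : ℕ} {X Z : Finset α}

theorem IsExtension.refl (q : α → Prop) (i : ℕ) (X : Finset α) : IsExtension q i X X :=
  ⟨subset_rfl, fun _ hz hz' => absurd hz hz', Nat.le_add_right _ _⟩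

theorem isExtension_zero_iff : IsExtension q 0 X Z ↔ Z = X := by
  refine ⟨fun h => (eq_of_subset_of_card_le h.subset h.card_le).symm, ?_⟩
  rintro rfl
  exact .refl q 0 _

theorem exists_isExtension_succ_iff [DecidableEq α] {P : Finset α → Prop} :
    (∃ Z, IsExtension q (i + 1) X Z ∧ P Z) ↔
      P X ∨ ∃ u, u ∉ X ∧ q u ∧ ∃ Z, IsExtension q i (insert u X) Z ∧ P Z := by
  constructor
  · rintro ⟨Z, hZ, hP⟩
    by_cases hXZ : X = Z
    · exact .inl (hXZ ▸ hP)
    obtain ⟨u, huZ, huX⟩ := exists_of_ssubset (hZ.subset.ssubset_of_ne hXZ)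
    refine .inr ⟨u, huX, hZ.prop u huZ huX, Z, ⟨insert_subset huZ hZ.subset, ?_, ?_⟩, hP⟩
    · exact fun z hz hz' => hZ.prop z hz fun hzX => hz' (mem_insert_of_mem hzX)
    · have := hZ.card_le
      rw [card_insert_of_notMem huX]
      omega
  · rintro (hP | ⟨u, huX, hu, Z, hZ, hP⟩)
    · exact ⟨X, .refl q _ X, hP⟩
    refine ⟨Z, ⟨(subset_insert _ _).trans hZ.subset, fun z hz hzX => ?_, ?_⟩, hP⟩
    · by_cases hzu : z = u
      · rwa [hzu]
      · exact hZ.prop z hz fun hz' => (mem_insert.mp hz').elim hzu hzX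
    · have := hZ.card_le
      rw [card_insert_of_notMem huX] at this
      omega

end IsExtension

/-- The table whose entries `(0, 0, v)` mark the vertices `v` of the core. -/
abbrev coreTable : Fin 8 := 0

namespace Term

/-- The vertex `x` belongs to the core. -/
def inCore (x : ℕ) : Term := .entry coreTable (.lit 0) (.lit 0) (.var x)

/-- The bound `coreBound d k i`, where `k` is the number of tokens. -/
def coreBound (d : ℕ) : ℕ → Term
  | 0 => .lit (2 * d)
  | i + 1 => .add (.mul tokens (coreBound d i)) (.lit 1)

/-- The vertex `y` is a closed neighbour of all vertices `10, …, 9 + j`. -/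
def adjacentToTuple (y : ℕ) : ℕ → Term
  | 0 => .lit 1
  | j + 1 => (adjacentToTuple y j).and (closedAdj (10 + j) y)

/-- The vertex `y` is none of the vertices `10, …, 9 + j`. -/
def notInTuple (y : ℕ) : ℕ → Term
  | 0 => .lit 1
  | j + 1 => (notInTuple y j).and ((Term.var (10 + j)).eq (.var y)).not

/-- The number of core vertices that are smaller than the vertex `2` and closed neighbours of all
vertices `10, …, 9 + j`. -/
def commonCount (j : ℕ) : Term :=
  countVertices 3 (((Term.var 3).lt (.var 2)).and ((inCore 3).and (adjacentToTuple 3 j)))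

/-- The vertices `10, …, 9 + j` have too many common closed neighbours. -/
def crowded (d j : ℕ) : Term := ((commonCount j).lt (coreBound d (d - j))).not

/-- The vertices `10, …, 9 + j` can be extended by at most `i` closed neighbours of the vertex `2`
to a set with too many common closed neighbours. -/
def crowdedExtension (d : ℕ) : ℕ → ℕ → Term
  | 0, j => crowded d j
  | i + 1, j => (crowded d j).or (sumVertices (10 + j)
      ((notInTuple (10 + j) j).and
        ((closedAdj (10 + j) 2).and (crowdedExtension d i (j + 1)))))

/-- The vertex `2` belongs to the core. -/
def core (d : ℕ) : Term := (crowdedExtension d d 0).not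

end Term

namespace Instance

variable (I : Instance)

/-- The tables after table `a` has been filled. -/
noncomputable def fill (a : Fin 8) (t : Term) (τ : Tables) : Tables :=
  (Cmd.fill a t).run I.encode 0 τ

variable {I} in
theorem fill_of_ne {a a' : Fin 8} (h : a' ≠ a) (t : Term) (τ : Tables) :
    I.fill a t τ a' = τ a' := by
  rw [fill, Cmd.run_fill, storeRange_of_ne _ _ h]

variable {x y z : ℕ}

theorem exists_fill_eq_value (a : Fin 8) (t : Term) (τ : Tables) (hx : x < I.side)
    (hy : y < I.side) (hz : z < I.side) : ∃ σ : Tables,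
      I.fill a t τ a (index I.side x y z) = I.value σ (env x y z) t ∧
      (∀ a', a' ≠ a → σ a' = τ a') ∧
      ∀ i < index I.side x y z, σ a i = I.fill a t τ a i := by
  have hlt := index_lt hx hy hz
  have hfill : I.fill a t τ = storeRange a
      (fun p σ => I.value σ (env (p / I.side / I.side) (p / I.side % I.side) (p % I.side)) t)
      (I.side * I.side * I.side) τ := Cmd.run_fill _ _ _ _
  rw [hfill]
  refine ⟨_, ?_, fun a' h => storeRange_of_ne _ _ h _ τ, fun i hi =>
    (storeRange_apply_of_le a _ hi hlt.le τ).symm⟩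
  rw [storeRange_apply _ _ hlt, index_div_div hy hz, index_div_mod hy hz, index_mod hz]

theorem exists_marked_fill_iff (a : Fin 8) (t : Term) (τ : Tables) (hx : x < I.side)
    (hy : y < I.side) (hz : z < I.side) : ∃ σ : Tables,
      (I.Marked (I.fill a t τ a) x y z ↔ I.Satisfies σ (env x y z) t) ∧
      (∀ a', a' ≠ a → σ a' = τ a') ∧
      ∀ i < index I.side x y z, σ a i = I.fill a t τ a i := by
  obtain ⟨σ, hvalue, hσ⟩ := I.exists_fill_eq_value a t τ hx hy hz
  exact ⟨σ, by rw [Marked, hvalue, Satisfies], hσ⟩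

open Classical in
/-- The set of vertices `v` that are marked at the position `(0, 0, v)`. -/
noncomputable def vertexSet (T : ℕ → ℕ) : Finset (Fin I.n) := {v | I.Marked T 0 0 v}

theorem mem_vertexSet {T : ℕ → ℕ} {v : Fin I.n} : v ∈ I.vertexSet T ↔ I.Marked T 0 0 v := by
  simp [vertexSet]

variable {τ : Tables} {ρ : ℕ → ℕ}

theorem satisfies_inCore {x : ℕ} {v : Fin I.n} (hx : ρ x = v) :
    I.Satisfies τ ρ (.inCore x) ↔ v ∈ I.vertexSet (τ coreTable) := by
  rw [Term.inCore, satisfies_entry, mem_vertexSet, value_var, hx]; rfl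

theorem value_coreBound (d i : ℕ) :
    I.value τ ρ (.coreBound d i) = coreBound d I.tokens i := by
  induction i with
  | zero => rfl
  | succ i ih =>
    rw [Term.coreBound, value_add, value_mul, value_tokens, ih, value_lit, coreBound]
    rw [value_tokens]
    exact I.tokens_le.trans I.n_lt_side.le

/-- The set `X` consists of the `j` distinct values of the variables `10, …, 9 + j`. -/
structure IsTuple (ρ : ℕ → ℕ) (j : ℕ) (X : Finset (Fin I.n)) : Prop where
  exists_mem : ∀ i < j, ∃ u ∈ X, ρ (10 + i) = u
  exists_of_mem : ∀ u ∈ X, ∃ i < j, ρ (10 + i) = u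
  card_eq : #X = j

namespace IsTuple

variable {I} {i j : ℕ} {X : Finset (Fin I.n)} {y : ℕ} {v : Fin I.n}

theorem empty (ρ : ℕ → ℕ) : I.IsTuple ρ 0 ∅ := ⟨by simp, by simp, rfl⟩

theorem update (h : I.IsTuple ρ j X) {x : ℕ} (hx : ∀ i < j, 10 + i ≠ x) (a : ℕ) :
    I.IsTuple (Function.update ρ x a) j X := by
  have hρ : ∀ i < j, Function.update ρ x a (10 + i) = ρ (10 + i) := fun i hi =>
    Function.update_of_ne (hx i hi) _ _
  refine ⟨fun i hi => by rw [hρ i hi]; exact h.exists_mem i hi, fun u hu => ?_, h.card_eq⟩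
  obtain ⟨i, hi, hiu⟩ := h.exists_of_mem u hu
  exact ⟨i, hi, by rw [hρ i hi, hiu]⟩

theorem insert (h : I.IsTuple ρ j X) {u : Fin I.n} (hu : u ∉ X) :
    I.IsTuple (Function.update ρ (10 + j) u) (j + 1) (insert u X) := by
  have h' : I.IsTuple (Function.update ρ (10 + j) u) j X := h.update (by omega) u
  refine ⟨fun i hi => ?_, fun v hv => ?_, by rw [card_insert_of_notMem hu, h.card_eq]⟩
  · rcases Nat.lt_succ_iff_lt_or_eq.mp hi with hi | rfl
    · obtain ⟨v, hv, hiv⟩ := h'.exists_mem i hi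
      exact ⟨v, mem_insert_of_mem hv, hiv⟩
    · exact ⟨u, mem_insert_self _ _, by simp⟩
  · rcases mem_insert.mp hv with rfl | hv
    · exact ⟨j, by omega, by simp⟩
    · obtain ⟨i, hi, hiv⟩ := h'.exists_of_mem v hv
      exact ⟨i, by omega, hiv⟩

theorem satisfies_adjacentToTuple (h : I.IsTuple ρ j X) (hy : ρ y = v) :
    I.Satisfies τ ρ (.adjacentToTuple y j) ↔ ∀ x ∈ X, ClosedAdj I.G x v := by
  have hforall : ∀ j, I.Satisfies τ ρ (.adjacentToTuple y j) ↔
      ∀ i < j, I.Satisfies τ ρ (.closedAdj (10 + i) y) := by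
    intro j
    induction j with
    | zero => simp [Term.adjacentToTuple, Satisfies]
    | succ j ih => rw [Term.adjacentToTuple, satisfies_and, ih, Nat.forall_lt_succ_right]
  rw [hforall]
  constructor
  · intro hall x hx
    obtain ⟨i, hi, hix⟩ := h.exists_of_mem x hx
    exact (I.satisfies_closedAdj hix hy).mp (hall i hi)
  · intro hall i hi
    obtain ⟨x, hx, hix⟩ := h.exists_mem i hi
    exact (I.satisfies_closedAdj hix hy).mpr (hall x hx)

theorem satisfies_notInTuple (h : I.IsTuple ρ j X) (hy : ρ y = v) :
    I.Satisfies τ ρ (.notInTuple y j) ↔ v ∉ X := by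
  have hforall : ∀ j, I.Satisfies τ ρ (.notInTuple y j) ↔ ∀ i < j, ρ (10 + i) ≠ v := by
    intro j
    induction j with
    | zero => simp [Term.notInTuple, Satisfies]
    | succ j ih =>
      rw [Term.notInTuple, satisfies_and, ih, Nat.forall_lt_succ_right, satisfies_not,
        satisfies_eq, value_var, value_var, hy]
  rw [hforall]
  constructor
  · intro hall hv
    obtain ⟨i, hi, hiv⟩ := h.exists_of_mem v hv
    exact hall i hi hiv
  · intro hv i hi hiv
    obtain ⟨x, hx, hix⟩ := h.exists_mem i hi
    exact hv (Fin.ext (hiv.symm.trans hix) ▸ hx)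

theorem value_commonCount (h : I.IsTuple ρ j X) (hv : ρ 2 = v) :
    I.value τ ρ (.commonCount j) =
      #{u ∈ commonClosedNeighbors I.G (I.vertexSet (τ coreTable)) X | u < v} := by
  rw [Term.commonCount, value_countVertices]
  congr 1
  ext u
  have hv' : Function.update ρ 3 u 2 = v := hv
  rw [mem_filter, mem_filter, mem_commonClosedNeighbors, satisfies_and, satisfies_and,
    satisfies_lt, value_var, value_var, hv', I.satisfies_inCore (v := u) (by simp),
    (h.update (by omega) u).satisfies_adjacentToTuple (v := u) (by simp), Function.update_self,
    Fin.lt_def, and_comm (a := u.val < v.val)]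
  simp

theorem satisfies_crowded (h : I.IsTuple ρ j X) (hv : ρ 2 = v) (d : ℕ) :
    I.Satisfies τ ρ (.crowded d j) ↔ coreBound d I.tokens (d - #X) ≤
      #{u ∈ commonClosedNeighbors I.G (I.vertexSet (τ coreTable)) X | u < v} := by
  rw [Term.crowded, satisfies_not, satisfies_lt, h.value_commonCount hv, value_coreBound, not_lt,
    h.card_eq]

theorem satisfies_crowdedExtension (d i : ℕ) (h : I.IsTuple ρ j X) (hv : ρ 2 = v) :
    I.Satisfies τ ρ (.crowdedExtension d i j) ↔
      ∃ Z, IsExtension (ClosedAdj I.G · v) i X Z ∧ coreBound d I.tokens (d - #Z) ≤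
        #{u ∈ commonClosedNeighbors I.G (I.vertexSet (τ coreTable)) Z | u < v} := by
  induction i generalizing ρ j X with
  | zero => simp [Term.crowdedExtension, h.satisfies_crowded hv, isExtension_zero_iff]
  | succ i ih =>
    rw [exists_isExtension_succ_iff, Term.crowdedExtension, satisfies_or, h.satisfies_crowded hv,
      satisfies_sumVertices]
    refine or_congr_right (exists_congr fun u => ?_)
    have hv' : Function.update ρ (10 + j) u 2 = v := by
      rw [Function.update_of_ne (by omega), hv]
    rw [satisfies_and, satisfies_and, I.satisfies_closedAdj (u := u) (by simp) hv',
      (h.update (by omega) u).satisfies_notInTuple (v := u) (by simp)]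
    exact and_congr_right fun hu => and_congr_right fun _ => ih (h.insert hu) hv'

end IsTuple

theorem satisfies_core (d : ℕ) {v : Fin I.n} (hv : ρ 2 = v) : I.Satisfies τ ρ (.core d) ↔
    ¬ ∃ X : Finset (Fin I.n), #X ≤ d ∧ (∀ x ∈ X, ClosedAdj I.G x v) ∧
      coreBound d I.tokens (d - #X) ≤
        #{u ∈ commonClosedNeighbors I.G (I.vertexSet (τ coreTable)) X | u < v} := by
  rw [Term.core, satisfies_not, (IsTuple.empty ρ).satisfies_crowdedExtension d d hv, not_iff_not]
  refine exists_congr fun X => ?_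
  rw [← and_assoc]
  refine and_congr_left fun _ => ⟨fun h => ⟨by simpa using h.card_le, fun x hx => ?_⟩, ?_⟩
  · exact h.prop x hx (notMem_empty x)
  · exact fun ⟨hcard, hadj⟩ => ⟨empty_subset X, fun x hx _ => hadj x hx, by simpa using hcard⟩

theorem isCore_fill (d : ℕ) (τ : Tables) :
    IsCore I.G d I.tokens (I.vertexSet (I.fill coreTable (.core d) τ coreTable)) := by
  intro v
  obtain ⟨σ, hmarked, -, hσ⟩ := I.exists_marked_fill_iff coreTable (.core d) τ I.side_pos
    I.side_pos (I.val_lt_side v)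
  rw [mem_vertexSet, hmarked, I.satisfies_core d (v := v) rfl, not_iff_not]
  refine exists_congr fun X => ?_
  have hfilter : {u ∈ commonClosedNeighbors I.G (I.vertexSet (σ coreTable)) X | u < v} =
      {u ∈ commonClosedNeighbors I.G
        (I.vertexSet (I.fill coreTable (.core d) τ coreTable)) X | u < v} := by
    ext u
    simp only [mem_filter, mem_commonClosedNeighbors, and_congr_left_iff, mem_vertexSet, Marked]
    intro huv _
    have hlt : index I.side 0 0 u < index I.side 0 0 v := Nat.add_lt_add_left huv _
    rw [hσ _ hlt]
  rw [hfilter]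

end Instance

/-! ## Computing the vertices of the kernel -/

/-- The table whose entries `(r, s, v)` mark the vertices `v` at distance at most `r` from `s`. -/
abbrev reachTable : Fin 8 := 1

/-- The table whose entries `(0, s, v)` are the distances. -/
abbrev distTable : Fin 8 := 2

/-- The table whose entries `(0, s, v)` mark the representatives `v` of the token `s`. -/
abbrev representativeTable : Fin 8 := 3

/-- The table whose entries `(t, s, v)` mark the vertices with `OnGeodesic t s v`. -/
abbrev geodesicTable : Fin 8 := 4

/-- The table whose entries `(0, 0, v)` mark the vertices `v` of the kernel. -/
abbrev keepTable : Fin 8 := 5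

namespace Term

/-- The distance from the vertex `1` to the vertex `2` is at most the value of the variable `0`. -/
def reach : Term :=
  (((Term.var 0).eq (.lit 0)).and ((Term.var 1).eq (.var 2))).or
    (((Term.lit 0).lt (.var 0)).and (sumVertices 3
      ((entry reachTable (.sub (.var 0) (.lit 1)) (.var 1) (.var 3)).and (closedAdj 3 2))))

/-- The distance from the vertex `1` to the vertex `2`, computed as the number of radii that do not
reach the vertex `2`. -/
def distance : Term :=
  .sum 3 (.ite (entry reachTable (.var 3) (.var 1) (.var 2)) (.lit 0) (.lit 1))

/-- The distance from the vertex `1` to the vertex `x`, read from the table. -/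
def dist (x : ℕ) : Term := entry distTable (.lit 0) (.var 1) (.var x)

/-- The bound `3 * k` on the relevant distances. -/
def radius : Term := .mul (.lit 3) tokens

/-- The vertices `x` and `y` have the same trace. -/
def sameTrace (x y : ℕ) : Term :=
  (sumVertices 4 ((inCore 4).and ((closedAdj x 4).iff (closedAdj y 4)).not)).not

/-- The vertex `x` precedes the vertex `y` as a candidate for a representative of the token `1`. -/
def precedes (x y : ℕ) : Term :=
  ((dist x).lt (dist y)).or (((dist x).eq (dist y)).and ((Term.var x).lt (.var y)))

/-- The vertex `2` is a representative of the token `1`. -/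
def representative : Term :=
  (mem 1).and (((dist 2).lt (.add radius (.lit 1))).and
    (sumVertices 3 ((sameTrace 3 2).and (precedes 3 2))).not)

/-- The vertex `x` is a neighbour of the vertex `y` that is closer to the vertex `1`. -/
def closerNeighbor (x y : ℕ) : Term := (adj x y).and ((Term.add (dist x) (.lit 1)).eq (dist y))

/-- The vertex `2` is the parent of the vertex `3` with respect to the vertex `1`. -/
def parent : Term :=
  (closerNeighbor 2 3).and (sumVertices 4 (((Term.var 4).lt (.var 2)).and (closerNeighbor 4 3))).not

/-- The entries of the table `geodesicTable`. -/
def geodesic : Term :=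
  (((Term.var 0).eq (.lit 0)).and (entry representativeTable (.lit 0) (.var 1) (.var 2))).or
    (((Term.lit 0).lt (.var 0)).and (sumVertices 3
      ((entry geodesicTable (.sub (.var 0) (.lit 1)) (.var 1) (.var 3)).and parent)))

/-- The vertex `2` belongs to the kernel. -/
def keep : Term :=
  (inCore 2).or ((mem 2).or
    (.sum 3 (sumVertices 4 (entry geodesicTable (.var 3) (.var 4) (.var 2)))))

end Term

open Classical in
theorem card_filter_not_le_natCast (x : ℕ∞) (N : ℕ) :
    (#((range N).filter fun r : ℕ => ¬ x ≤ r) : ℕ∞) = min x N := by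
  induction x with
  | top => simp
  | coe a =>
    have hrange : ((range N).filter fun r : ℕ => ¬ (a : ℕ∞) ≤ r) = range (min a N) := by
      ext r
      simp only [mem_filter, mem_range, Nat.cast_le, not_le, lt_min_iff, and_comm]
    rw [hrange, card_range]
    rfl

namespace Instance

variable (I : Instance)

/-- The marked entries `(r, s, v)` are those for which the distance from `s` to `v` is at most
`r`. -/
def IsReachTable (T : ℕ → ℕ) : Prop :=
  ∀ r < I.side, ∀ s v : Fin I.n, I.Marked T r s v ↔ I.G.edist s v ≤ r

/-- The entries `(0, s, v)` are the distances, truncated at the side length of the table. -/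
def IsDistTable (T : ℕ → ℕ) : Prop :=
  ∀ s v : Fin I.n, (T (index I.side 0 s v) : ℕ∞) = min (I.G.edist s v) I.side

/-- The marked entries `(0, s, v)` are those for which `v` is a representative of `s`. -/
def IsRepresentativeTable (C : Finset (Fin I.n)) (T : ℕ → ℕ) : Prop :=
  ∀ s v : Fin I.n, I.Marked T 0 s v ↔ IsRepresentative I.G I.S C s v

/-- The marked entries `(t, s, v)` are those with `OnGeodesic t s v`. -/
def IsGeodesicTable (C : Finset (Fin I.n)) (T : ℕ → ℕ) : Prop :=
  ∀ t < I.side, ∀ s v : Fin I.n, I.Marked T t s v ↔ OnGeodesic I.G I.S C t s v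

theorem isReachTable_fill (τ : Tables) :
    I.IsReachTable (I.fill reachTable .reach τ reachTable) := by
  intro r hr s v
  obtain ⟨σ, hmarked, -, hσ⟩ := I.exists_marked_fill_iff reachTable .reach τ hr (I.val_lt_side s)
    (I.val_lt_side v)
  rw [hmarked, Term.reach]
  cases r with
  | zero => simp [env, ← Fin.ext_iff]
  | succ r =>
    have hprev : ∀ u : Fin I.n, I.Marked (σ reachTable) r s u ↔ I.G.edist s u ≤ r := fun u => by
      rw [← isReachTable_fill τ r (by omega) s u, Marked, Marked,
        hσ _ (index_lt_index r.lt_succ_self (I.val_lt_side s) (I.val_lt_side u))]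
    have hadj : ∀ u : Fin I.n, I.Satisfies σ (Function.update (env (r + 1) s v) 3 u)
        (.closedAdj 3 2) ↔ ClosedAdj I.G u v := fun u => I.satisfies_closedAdj rfl rfl
    simp [env, hadj, hprev, edist_le_add_one_iff]

variable {I} {τ : Tables} {ρ : ℕ → ℕ} {T : ℕ → ℕ} {C : Finset (Fin I.n)}

theorem isDistTable_fill (h : I.IsReachTable (τ reachTable)) :
    I.IsDistTable (I.fill distTable .distance τ distTable) := by
  classical
  intro s v
  obtain ⟨σ, hvalue, hσ, -⟩ := I.exists_fill_eq_value distTable .distance τ I.side_pos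
    (I.val_lt_side s) (I.val_lt_side v)
  rw [hvalue, Term.distance, value_sum, ← card_filter_not_le_natCast, card_filter]
  congr 1
  refine sum_congr rfl fun r hr => ?_
  rw [value_ite, value_lit, value_lit, ite_not]
  refine if_congr ?_ rfl rfl
  rw [satisfies_entry, hσ reachTable (by decide)]
  exact h r (mem_range.mp hr) s v

namespace IsDistTable

variable {r : ℕ} {s u v w : Fin I.n}

theorem lt_succ_iff (h : I.IsDistTable T) (hr : r < I.side) :
    T (index I.side 0 s v) < r + 1 ↔ I.G.edist s v ≤ r := by
  rw [Nat.lt_succ_iff, ← Nat.cast_le (α := ℕ∞), h, min_le_iff, or_iff_left]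
  exact_mod_cast hr.not_ge

theorem lt_iff (h : I.IsDistTable T) (hv : I.G.edist s v < I.side) :
    T (index I.side 0 s u) < T (index I.side 0 s v) ↔ I.G.edist s u < I.G.edist s v := by
  rw [← Nat.cast_lt (α := ℕ∞), h, h, min_eq_left hv.le, min_lt_iff, or_iff_left hv.not_gt]

theorem eq_iff (h : I.IsDistTable T) (hv : I.G.edist s v < I.side) :
    T (index I.side 0 s u) = T (index I.side 0 s v) ↔ I.G.edist s u = I.G.edist s v := by
  rw [← Nat.cast_inj (R := ℕ∞), h, h, min_eq_left hv.le]
  grind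

theorem add_one_eq_iff (h : I.IsDistTable T) (hw : I.G.edist s w < I.side) :
    T (index I.side 0 s v) + 1 = T (index I.side 0 s w) ↔
      I.G.edist s v + 1 = I.G.edist s w := by
  rw [← Nat.cast_inj (R := ℕ∞), Nat.cast_succ, h, h, min_eq_left hw.le]
  rcases le_total (I.G.edist s v) I.side with hv | hv
  · rw [min_eq_left hv]
  · rw [min_eq_right hv]
    have hlt : I.G.edist s w < I.side + 1 := hw.trans_le le_self_add
    exact iff_of_false hlt.ne' (hlt.trans_le (add_le_add_left hv 1)).ne'

end IsDistTable

theorem satisfies_sameTrace {x y : ℕ} {u v : Fin I.n} (hx : ρ x = u) (hy : ρ y = v)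
    (hx₄ : x ≠ 4) (hy₄ : y ≠ 4) : I.Satisfies τ ρ (.sameTrace x y) ↔
      trace I.G (I.vertexSet (τ coreTable)) u = trace I.G (I.vertexSet (τ coreTable)) v := by
  rw [Term.sameTrace, satisfies_not, satisfies_sumVertices, trace_eq_trace_iff, not_exists]
  have hcore : ∀ c : Fin I.n, I.Satisfies τ (Function.update ρ 4 c) (.inCore 4) ↔
      c ∈ I.vertexSet (τ coreTable) := fun c => I.satisfies_inCore rfl
  have hadj : ∀ {x : ℕ} {u : Fin I.n}, ρ x = u → x ≠ 4 → ∀ c : Fin I.n,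
      I.Satisfies τ (Function.update ρ 4 c) (.closedAdj x 4) ↔ ClosedAdj I.G u c :=
    fun hx hx₄ c => I.satisfies_closedAdj (by rw [Function.update_of_ne hx₄, hx]) rfl
  simp only [satisfies_and, satisfies_not, satisfies_iff, hcore, hadj hx hx₄, hadj hy hy₄, not_and,
    not_not]

theorem value_dist {x : ℕ} {s v : Fin I.n} (hs : ρ 1 = s) (hx : ρ x = v) :
    I.value τ ρ (.dist x) = τ distTable (index I.side 0 s v) := by
  rw [Term.dist, value_entry, value_lit, value_var, value_var, hs, hx]

theorem value_radius : I.value τ ρ .radius = 3 * I.tokens := by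
  rw [Term.radius, value_mul, value_lit, value_tokens]
  rw [value_lit, side_eq]
  omega

theorem satisfies_precedes (hdist : I.IsDistTable (τ distTable)) {x y : ℕ} {s u v : Fin I.n}
    (hs : ρ 1 = s) (hx : ρ x = u) (hy : ρ y = v) (hv : I.G.edist s v < I.side) :
    I.Satisfies τ ρ (.precedes x y) ↔
      toLex (I.G.edist s u, u) < toLex (I.G.edist s v, v) := by
  rw [Term.precedes, satisfies_or, satisfies_and, satisfies_lt, satisfies_lt, satisfies_eq,
    value_dist hs hx, value_dist hs hy, hdist.lt_iff hv, hdist.eq_iff hv, value_var, value_var, hx,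
    hy, Prod.Lex.toLex_lt_toLex, Fin.lt_def]

theorem natCast_three_mul_tokens_lt_side : (3 * #I.S : ℕ∞) < I.side := by
  exact_mod_cast I.three_mul_tokens_lt_side

theorem isRepresentativeTable_fill (hdist : I.IsDistTable (τ distTable)) :
    I.IsRepresentativeTable (I.vertexSet (τ coreTable))
      (I.fill representativeTable .representative τ representativeTable) := by
  intro s v
  obtain ⟨σ, hmarked, hσ, -⟩ := I.exists_marked_fill_iff representativeTable .representative τ
    I.side_pos (I.val_lt_side s) (I.val_lt_side v)
  rw [← hσ distTable (by decide)] at hdist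
  rw [hmarked, Term.representative, satisfies_and, satisfies_and, satisfies_lt, satisfies_not,
    satisfies_sumVertices, I.satisfies_mem (u := s) rfl, value_dist (s := s) (v := v) rfl rfl,
    value_add, value_radius, value_lit, hdist.lt_succ_iff I.three_mul_tokens_lt_side]
  have hprecedes : I.G.edist s v ≤ 3 * #I.S → ∀ u : Fin I.n,
      I.Satisfies σ (Function.update (env 0 s v) 3 u) ((Term.sameTrace 3 2).and (.precedes 3 2)) ↔
      trace I.G (I.vertexSet (τ coreTable)) u = trace I.G (I.vertexSet (τ coreTable)) v ∧
        toLex (I.G.edist s u, u) < toLex (I.G.edist s v, v) := fun hv u => by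
    rw [satisfies_and, satisfies_sameTrace (u := u) (v := v) rfl rfl (by decide) (by decide),
      satisfies_precedes hdist (s := s) (u := u) (v := v) rfl rfl rfl
        (hv.trans_lt natCast_three_mul_tokens_lt_side), hσ coreTable (by decide)]
  have hcast : ((3 * I.tokens : ℕ) : ℕ∞) = 3 * #I.S := by push_cast; rfl
  rw [hcast]
  constructor
  · rintro ⟨hs, hv, hmin⟩
    refine ⟨hs, hv, fun u hu => not_lt.mp fun hlt => hmin ⟨u, ?_⟩⟩
    exact (hprecedes hv u).mpr ⟨hu, hlt⟩
  · rintro ⟨hs, hv, hmin⟩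
    refine ⟨hs, hv, fun ⟨u, hu⟩ => ?_⟩
    obtain ⟨htrace, hlt⟩ := (hprecedes hv u).mp hu
    exact (hmin u htrace).not_gt hlt

theorem satisfies_closerNeighbor (hdist : I.IsDistTable (τ distTable)) {x y : ℕ}
    {s v w : Fin I.n} (hs : ρ 1 = s) (hx : ρ x = v) (hy : ρ y = w)
    (hw : I.G.edist s w < I.side) : I.Satisfies τ ρ (.closerNeighbor x y) ↔
      I.G.Adj v w ∧ I.G.edist s v + 1 = I.G.edist s w := by
  rw [Term.closerNeighbor, satisfies_and, I.satisfies_adj hx hy, satisfies_eq, value_add,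
    value_dist hs hx, value_dist hs hy, value_lit, hdist.add_one_eq_iff hw]

theorem satisfies_parent (hdist : I.IsDistTable (τ distTable)) {s v w : Fin I.n} (hs : ρ 1 = s)
    (hv : ρ 2 = v) (hw : ρ 3 = w) (hsw : I.G.edist s w < I.side) :
    I.Satisfies τ ρ .parent ↔ IsParent I.G s w v := by
  rw [Term.parent, satisfies_and, satisfies_not, satisfies_sumVertices,
    satisfies_closerNeighbor hdist hs hv hw hsw, IsParent, IsLeast, mem_lowerBounds]
  refine and_congr_right fun _ => not_exists.trans (forall_congr' fun u => ?_)
  have hs' : Function.update ρ 4 u 1 = s := hs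
  have hv' : Function.update ρ 4 u 2 = v := hv
  have hw' : Function.update ρ 4 u 3 = w := hw
  rw [satisfies_and, satisfies_lt, value_var, value_var, hv', Function.update_self,
    satisfies_closerNeighbor hdist (v := u) hs' rfl hw' hsw, ← Fin.lt_def, not_and', not_lt]
  rfl

theorem isGeodesicTable_fill (hdist : I.IsDistTable (τ distTable))
    (hrep : I.IsRepresentativeTable C (τ representativeTable)) :
    I.IsGeodesicTable C (I.fill geodesicTable .geodesic τ geodesicTable) := by
  intro t ht s v
  obtain ⟨σ, hmarked, hστ, hσ⟩ := I.exists_marked_fill_iff geodesicTable .geodesic τ ht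
    (I.val_lt_side s) (I.val_lt_side v)
  rw [hmarked, Term.geodesic]
  cases t with
  | zero =>
    have hzero : OnGeodesic I.G I.S C 0 s v ↔ IsRepresentative I.G I.S C s v :=
      ⟨fun h => by cases h with | zero h => exact h, .zero⟩
    simp [env, hzero, ← hrep s v, hστ representativeTable (by decide)]
  | succ t =>
    have hsucc : OnGeodesic I.G I.S C (t + 1) s v ↔
        ∃ w, OnGeodesic I.G I.S C t s w ∧ IsParent I.G s w v :=
      ⟨fun h => by cases h with | succ h h' => exact ⟨_, h, h'⟩, fun ⟨_, h, h'⟩ => h.succ h'⟩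
    have hprev : ∀ w : Fin I.n, I.Marked (σ geodesicTable) t s w ↔
        OnGeodesic I.G I.S C t s w := fun w => by
      rw [← isGeodesicTable_fill hdist hrep t (by omega) s w, Marked, Marked,
        hσ _ (index_lt_index t.lt_succ_self (I.val_lt_side s) (I.val_lt_side w))]
    have hparent : ∀ w : Fin I.n, OnGeodesic I.G I.S C t s w →
        (I.Satisfies σ (Function.update (env (t + 1) s v) 3 w) .parent ↔ IsParent I.G s w v) :=
      fun w hw => satisfies_parent (by rwa [hστ distTable (by decide)]) rfl rfl rfl
        ((le_add_self.trans hw.add_edist_le).trans_lt natCast_three_mul_tokens_lt_side)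
    rw [hsucc, ← exists_congr fun w => and_congr_right (hparent w)]
    simp [env, hprev]

theorem vertexSet_fill_keep
    (hgeodesic : I.IsGeodesicTable (I.vertexSet (τ coreTable)) (τ geodesicTable)) :
    I.vertexSet (I.fill keepTable .keep τ keepTable) =
      kernelVertices I.G I.S (I.vertexSet (τ coreTable)) := by
  ext v
  obtain ⟨σ, hmarked, hσ, -⟩ := I.exists_marked_fill_iff keepTable .keep τ I.side_pos I.side_pos
    (I.val_lt_side v)
  rw [mem_vertexSet, hmarked, mem_kernelVertices, Term.keep, satisfies_or, satisfies_or,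
    I.satisfies_inCore (v := v) rfl, I.satisfies_mem (u := v) rfl, satisfies_sum,
    hσ coreTable (by decide)]
  refine or_congr_right (or_congr_right (exists_congr fun t => ?_))
  have hentry : ∀ s : Fin I.n, I.Satisfies σ (Function.update (Function.update (env 0 0 v) 3 t) 4 s)
      (.entry geodesicTable (.var 3) (.var 4) (.var 2)) ↔ I.Marked (τ geodesicTable) t s v :=
    fun s => by rw [satisfies_entry, hσ geodesicTable (by decide)]; rfl
  simp only [satisfies_sumVertices, hentry]
  constructor
  · rintro ⟨ht, s, h⟩
    exact ⟨s, (hgeodesic t ht s v).mp h⟩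
  · rintro ⟨s, h⟩
    have ht : t < I.side := h.le.trans_lt I.three_mul_tokens_lt_side
    exact ⟨ht, s, (hgeodesic t ht s v).mpr h⟩

variable (I) in
/-- The tables after all steps of the algorithm except for the output. -/
noncomputable def kernelTables (d : ℕ) : Tables :=
  I.fill keepTable .keep (I.fill geodesicTable .geodesic (I.fill representativeTable .representative
    (I.fill distTable .distance (I.fill reachTable .reach (I.fill coreTable (.core d) 0)))))

theorem exists_isCore_vertexSet_kernelTables (I : Instance) (d : ℕ) : ∃ C,
    IsCore I.G d I.tokens C ∧
      I.vertexSet (I.kernelTables d keepTable) = kernelVertices I.G I.S C := by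
  set τ₀ := I.fill coreTable (.core d) 0
  set τ₁ := I.fill reachTable .reach τ₀ with hτ₁
  set τ₂ := I.fill distTable .distance τ₁ with hτ₂
  set τ₃ := I.fill representativeTable .representative τ₂ with hτ₃
  set τ₄ := I.fill geodesicTable .geodesic τ₃ with hτ₄
  have hdist : I.IsDistTable (τ₂ distTable) := isDistTable_fill (I.isReachTable_fill τ₀)
  have hrep : I.IsRepresentativeTable (I.vertexSet (τ₂ coreTable)) (τ₃ representativeTable) :=
    isRepresentativeTable_fill hdist
  have hgeodesic : I.IsGeodesicTable (I.vertexSet (τ₂ coreTable)) (τ₄ geodesicTable) :=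
    isGeodesicTable_fill (by rwa [hτ₃, fill_of_ne (by decide)]) hrep
  have hcore : τ₄ coreTable = τ₂ coreTable := by
    rw [hτ₄, fill_of_ne (by decide), hτ₃, fill_of_ne (by decide)]
  have hcore₀ : τ₂ coreTable = τ₀ coreTable := by
    rw [hτ₂, fill_of_ne (by decide), hτ₁, fill_of_ne (by decide)]
  rw [← hcore] at hgeodesic
  exact ⟨I.vertexSet (τ₄ coreTable), by rw [hcore, hcore₀]; exact I.isCore_fill d 0,
    vertexSet_fill_keep hgeodesic⟩

end Instance

/-! ## Computing the output -/

theorem card_filter_lt_orderEmbOfFin {α : Type*} [LinearOrder α] (K : Finset α) (i : Fin #K) :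
    #{v ∈ K | v < K.orderEmbOfFin rfl i} = i := by
  have hbelow : {v ∈ K | v < K.orderEmbOfFin rfl i} =
      (Iio i).map (K.orderEmbOfFin rfl).toEmbedding := by
    ext v
    simp only [mem_filter, mem_map, mem_Iio]
    constructor
    · rintro ⟨hv, hlt⟩
      obtain ⟨j, rfl⟩ : v ∈ Set.range (K.orderEmbOfFin rfl) := by rwa [range_orderEmbOfFin]
      exact ⟨j, (K.orderEmbOfFin rfl).lt_iff_lt.mp hlt, rfl⟩
    · rintro ⟨j, hj, rfl⟩
      exact ⟨orderEmbOfFin_mem _ _ _, (K.orderEmbOfFin rfl).lt_iff_lt.mpr hj⟩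
  rw [hbelow, card_map, Fin.card_Iio]

theorem exists_val_mul_add_val_eq {m p : ℕ} (hp : p < m * m) :
    ∃ i j : Fin m, i.val * m + j.val = p := by
  have hm : 0 < m := Nat.pos_of_mul_pos_left (Nat.zero_lt_of_lt hp)
  exact ⟨⟨p / m, Nat.div_lt_of_lt_mul hp⟩, ⟨p % m, Nat.mod_lt _ hm⟩, Nat.div_add_mod' p m⟩

theorem val_mul_add_val_inj {m : ℕ} {i j i' j' : Fin m} :
    i.val * m + j.val = i'.val * m + j'.val ↔ i = i' ∧ j = j' := by
  refine ⟨fun h => ?_, fun ⟨hi, hj⟩ => hi ▸ hj ▸ rfl⟩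
  have hpair : finProdFinEquiv (i, j) = finProdFinEquiv (i', j') := Fin.ext <| by
    simpa only [finProdFinEquiv_apply_val, add_comm, mul_comm] using h
  simpa using hpair

theorem val_mul_add_val_lt {m : ℕ} (i j : Fin m) : i.val * m + j.val < m * m := by
  simpa only [finProdFinEquiv_apply_val, add_comm, mul_comm] using (finProdFinEquiv (i, j)).isLt

namespace Instance

variable (I : Instance)

/-- Cell `p` lies behind the budget and holds a one when the encoding of the instance has been
loaded into the memory. -/
def HasBit (p : ℕ) : Prop :=
  (∃ u v : Fin I.n, p = 3 + u.val * I.n + v.val ∧ I.G.Adj u v) ∨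
    ∃ v : Fin I.n, p = 3 + I.n * I.n + v.val ∧ v ∈ I.S

open Classical in
theorem load_encode_eq_ite_hasBit {p : ℕ} (hp : 3 ≤ p) (hp' : p ≤ I.encode.length) :
    load I.encode p = if I.HasBit p then 1 else 0 := by
  rw [length_encode] at hp'
  obtain ⟨q, rfl⟩ := Nat.exists_eq_add_of_le hp
  rcases lt_or_ge q (I.n * I.n) with hq | hq
  · obtain ⟨u, v, rfl⟩ := exists_val_mul_add_val_eq hq
    rw [← add_assoc, load_encode_adj]
    refine if_congr ⟨fun h => .inl ⟨u, v, rfl, h⟩, ?_⟩ rfl rfl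
    rintro (⟨u', v', h, hadj⟩ | ⟨v', h, -⟩)
    · have heq : u.val * I.n + v.val = u'.val * I.n + v'.val := by omega
      obtain ⟨rfl, rfl⟩ := val_mul_add_val_inj.mp heq
      exact hadj
    · omega
  · obtain ⟨v, rfl⟩ : ∃ v : Fin I.n, q = I.n * I.n + v.val :=
      ⟨⟨q - I.n * I.n, by omega⟩, by simp only; omega⟩
    rw [← add_assoc, load_encode_mem]
    refine if_congr ⟨fun h => .inr ⟨v, rfl, h⟩, ?_⟩ rfl rfl
    rintro (⟨u', v', h, -⟩ | ⟨v', h, hmem⟩)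
    · have := val_mul_add_val_lt u' v'
      omega
    · obtain rfl : v = v' := Fin.ext (by omega)
      exact hmem

end Instance

/-- The table whose entries `(0, 0, p)` are the cells of the output word. -/
abbrev outTable : Fin 8 := 6

namespace Term

/-- The vertex `x` belongs to the kernel, as read from the table. -/
def kept (x : ℕ) : Term := entry keepTable (.lit 0) (.lit 0) (.var x)

/-- The number of vertices of the kernel. -/
def keptCount : Term := countVertices 5 (kept 5)

/-- The number of vertices of the kernel that are smaller than the vertex `x`. -/
def rank (x : ℕ) : Term := countVertices 5 ((kept 5).and ((Term.var 5).lt (.var x)))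

/-- The budget of the kernel. -/
def budget : Term :=
  .ite ((Term.inp (.lit 2)).lt (.mul radius tokens)) (.inp (.lit 2)) (.mul radius tokens)

/-- The cell with the address given by the variable `2` holds an adjacency of the kernel. -/
def adjBit : Term :=
  sumVertices 3 ((kept 3).and (sumVertices 4 ((kept 4).and
    (((Term.var 2).eq (.add (.add (.lit 3) (.mul (rank 3) keptCount)) (rank 4))).and (adj 3 4)))))

/-- The cell with the address given by the variable `2` holds a token of the kernel. -/
def memBit : Term :=
  sumVertices 3 ((kept 3).and
    (((Term.var 2).eq (.add (.add (.lit 3) (.mul keptCount keptCount)) (rank 3))).and (mem 3)))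

/-- The output in the cell with the address given by the variable `2`. -/
def output : Term :=
  .ite ((Term.var 2).eq (.lit 0)) (.add (.add (.mul keptCount keptCount) keptCount) (.lit 2))
    (.ite ((Term.var 2).eq (.lit 1)) keptCount
      (.ite ((Term.var 2).eq (.lit 2)) budget
        (.ite (adjBit.or memBit) (.lit 1) (.lit 0))))

end Term

namespace Instance

variable {I : Instance} {τ : Tables} {ρ : ℕ → ℕ} {K : Finset (Fin I.n)} {b p : ℕ}

theorem satisfies_kept {x : ℕ} {v : Fin I.n} (hx : ρ x = v) :
    I.Satisfies τ ρ (.kept x) ↔ v ∈ I.vertexSet (τ keepTable) := by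
  rw [Term.kept, satisfies_entry, mem_vertexSet, value_var, hx]; rfl

theorem value_keptCount : I.value τ ρ .keptCount = #(I.vertexSet (τ keepTable)) := by
  rw [Term.keptCount, value_countVertices]
  congr 1
  ext u
  simpa using satisfies_kept (v := u) (by simp)

theorem value_keptCount_le_side : I.value τ ρ .keptCount ≤ I.side := by
  rw [value_keptCount]
  exact (card_finset_fin_le _).trans I.n_lt_side.le

theorem value_rank {x : ℕ} (hx₅ : x ≠ 5) (hK : I.vertexSet (τ keepTable) = K)
    {i : Fin (I.restrict K b).n} (hx : ρ x = I.inclusion K b i) :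
    I.value τ ρ (.rank x) = i := by
  subst hK
  rw [Term.rank, value_countVertices]
  refine (congr_arg card ?_).trans (card_filter_lt_orderEmbOfFin (I.vertexSet (τ keepTable)) i)
  ext u
  rw [mem_filter, mem_filter, satisfies_and, satisfies_lt, value_var, value_var,
    satisfies_kept (v := u) (by simp), Function.update_self, Function.update_of_ne hx₅, hx]
  simp only [mem_univ, true_and]
  rfl

theorem value_rank_le_side {x : ℕ} : I.value τ ρ (.rank x) ≤ I.side := by
  rw [Term.rank, value_countVertices]
  exact (card_finset_fin_le _).trans I.n_lt_side.le

theorem value_budget : I.value τ ρ .budget = min I.b (3 * #I.S * #I.S) := by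
  have hinp : I.value τ ρ (.inp (.lit 2)) = I.b := rfl
  have hmul : I.value τ ρ (.mul .radius .tokens) = 3 * #I.S * #I.S := by
    rw [value_mul, value_radius, value_tokens, tokens]
    rw [value_radius]
    exact I.three_mul_tokens_lt_side.le
  rw [Term.budget, value_ite, hinp, hmul, min_def_lt]
  exact if_congr (by rw [satisfies_lt, hinp, hmul]) rfl rfl

theorem exists_mem_and_iff_exists_inclusion {P : Fin I.n → Prop} :
    (∃ v, v ∈ K ∧ P v) ↔ ∃ i, P (I.inclusion K b i) := by
  rw [← Set.exists_range_iff, range_inclusion]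
  rfl

theorem exists_satisfies_kept_and_iff (hK : I.vertexSet (τ keepTable) = K) {x : ℕ}
    {P : Fin I.n → Prop} :
    (∃ u : Fin I.n, I.Satisfies τ (Function.update ρ x u) (.kept x) ∧ P u) ↔
      ∃ i, P (I.inclusion K b i) := by
  rw [← exists_mem_and_iff_exists_inclusion, ← hK]
  exact exists_congr fun u => and_congr_left fun _ => satisfies_kept (by simp)

theorem satisfies_adjBit (hK : I.vertexSet (τ keepTable) = K) :
    I.Satisfies τ ρ .adjBit ↔ ∃ i j : Fin (I.restrict K b).n,
      ρ 2 = 3 + i.val * (I.restrict K b).n + j.val ∧ (I.restrict K b).G.Adj i j := by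
  simp only [Term.adjBit, satisfies_sumVertices, satisfies_and,
    exists_satisfies_kept_and_iff (b := b) hK]
  refine exists_congr fun i => exists_congr fun j => and_congr ?_ ?_
  · rw [satisfies_eq, value_add, value_add, value_mul _ _ _ _ value_rank_le_side,
      value_rank (by decide) hK (i := i) rfl, value_rank (by decide) hK (i := j) rfl,
      value_keptCount, hK]
    rfl
  · exact I.satisfies_adj (u := I.inclusion K b i) (v := I.inclusion K b j) rfl rfl

theorem satisfies_memBit (hK : I.vertexSet (τ keepTable) = K) :
    I.Satisfies τ ρ .memBit ↔ ∃ i : Fin (I.restrict K b).n,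
      ρ 2 = 3 + (I.restrict K b).n * (I.restrict K b).n + i.val ∧ i ∈ (I.restrict K b).S := by
  simp only [Term.memBit, satisfies_sumVertices, satisfies_and,
    exists_satisfies_kept_and_iff (b := b) hK]
  refine exists_congr fun i => and_congr ?_ ?_
  · rw [satisfies_eq, value_add, value_add, value_mul _ _ _ _ value_keptCount_le_side,
      value_rank (by decide) hK (i := i) rfl, value_keptCount, hK]
    rfl
  · rw [mem_restrict_S]
    exact I.satisfies_mem (by simp)

theorem value_output (hK : I.vertexSet (τ keepTable) = K)
    (hb : b = min I.b (3 * #I.S * #I.S)) (hp : ρ 2 ≤ (I.restrict K b).encode.length) :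
    I.value τ ρ .output = load (I.restrict K b).encode (ρ 2) := by
  classical
  rw [Term.output, value_ite, value_ite, value_ite, value_ite]
  simp only [satisfies_eq, value_var, value_lit]
  split_ifs with h₀ h₁ h₂ hbit
  · rw [h₀, load, length_encode, value_add, value_add, value_mul _ _ _ _ value_keptCount_le_side,
      value_keptCount, hK]
    rfl
  · rw [h₁, value_keptCount, hK]
    rfl
  · rw [h₂, value_budget, ← hb]
    rfl
  all_goals
    rw [satisfies_or, satisfies_adjBit hK, satisfies_memBit hK] at hbit
    rw [load_encode_eq_ite_hasBit _ (by omega) hp]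
  · exact (if_pos hbit).symm
  · exact (if_neg hbit).symm

variable (I)

/-- The kernel of the instance `I`, for graphs without `K_{d,d}`. Each of the `k` tokens needs at
most `3 * k` steps, hence the bound `3 * k * k` on the budget. -/
noncomputable def kernel (d : ℕ) : Instance :=
  I.restrict (I.vertexSet (I.kernelTables d keepTable)) (min I.b (3 * #I.S * #I.S))

theorem length_encode_kernel_le (d : ℕ) : (I.kernel d).encode.length ≤ I.encode.length := by
  have hn : (I.kernel d).n ≤ I.n :=
    card_finset_fin_le (I.vertexSet (I.kernelTables d keepTable))
  rw [length_encode, length_encode]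
  gcongr

end Instance

/-- The algorithm that computes the kernel. -/
def kernelCmd (d : ℕ) : Cmd :=
  .seq (.fill coreTable (.core d)) (.seq (.fill reachTable .reach) (.seq
    (.fill distTable .distance) (.seq (.fill representativeTable .representative) (.seq
      (.fill geodesicTable .geodesic) (.seq (.fill keepTable .keep) (.fill outTable .output))))))

theorem Instance.run_kernelCmd (I : Instance) (d : ℕ) {p : ℕ}
    (hp : p ≤ (I.kernel d).encode.length) :
    (kernelCmd d).run I.encode 0 0 outTable p = load (I.kernel d).encode p := by
  have hrun : (kernelCmd d).run I.encode 0 0 = I.fill outTable .output (I.kernelTables d) := rfl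
  have hindex : index I.side 0 0 p = p := by simp [index]
  obtain ⟨σ, hvalue, hσ, -⟩ := I.exists_fill_eq_value outTable .output (I.kernelTables d)
    I.side_pos I.side_pos (Nat.lt_succ_of_le (hp.trans (I.length_encode_kernel_le d)))
  rw [hindex] at hvalue
  rw [hrun, hvalue]
  exact value_output (by rw [hσ keepTable (by decide)]) rfl hp

/-! ## The size of the kernel -/

namespace Instance

variable (I : Instance)

theorem size_le : I.size ≤ I.n + I.b + 2 + 2 * (I.n * I.n + I.n) := by
  have size_le_self (m : ℕ) : Nat.size m ≤ m := Nat.size_le.mpr Nat.lt_two_pow_self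
  have hbits : ∀ a ∈ (I.encode.drop 2).map fun a => Nat.size a + 1, a ≤ 2 := by
    simp only [encode, List.drop_succ_cons, List.drop_zero, List.mem_map, List.mem_append,
      List.mem_flatMap, List.mem_finRange, true_and]
    rintro _ ⟨_, ⟨u, v, rfl⟩ | ⟨v, rfl⟩, rfl⟩ <;> split_ifs <;> simp
  have hsum := List.sum_le_card_nsmul _ 2 hbits
  rw [List.length_map, List.length_drop, length_encode, Nat.add_sub_cancel, smul_eq_mul] at hsum
  calc I.size = Nat.size I.n + 1 + (Nat.size I.b + 1 +
        ((I.encode.drop 2).map fun a => Nat.size a + 1).sum) := rfl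
    _ ≤ I.n + 1 + (I.b + 1 + (I.n * I.n + I.n) * 2) := by gcongr <;> apply size_le_self
    _ = I.n + I.b + 2 + 2 * (I.n * I.n + I.n) := by ring

end Instance

open Polynomial in
/-- The bound `coreBound d k i` as a polynomial in `k`. -/
noncomputable def coreBoundPoly (d : ℕ) : ℕ → ℕ[X]
  | 0 => C (2 * d)
  | i + 1 => X * coreBoundPoly d i + 1

theorem eval_coreBoundPoly (d k i : ℕ) : (coreBoundPoly d i).eval k = coreBound d k i := by
  induction i with
  | zero => simp [coreBoundPoly, coreBound]
  | succ i ih => simp [coreBoundPoly, coreBound, ih]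

open Polynomial in
/-- A bound for the number of vertices of the kernel, as a polynomial in the number of tokens. -/
noncomputable def kernelPoly (d : ℕ) : ℕ[X] :=
  coreBoundPoly d d + X + (C 3 * X + 1) *
    (X * (C d * (coreBoundPoly d d + 1) ^ d + coreBoundPoly d d ^ d * C (2 * d)))

open Polynomial in
/-- A bound for the size of the kernel, as a polynomial in the number of tokens. -/
noncomputable def kernelSizePoly (d : ℕ) : ℕ[X] :=
  kernelPoly d + C 3 * X * X + C 2 + C 2 * (kernelPoly d * kernelPoly d + kernelPoly d)

theorem le_eval_kernelSizePoly (d k : ℕ) : k ≤ (kernelSizePoly d).eval k := by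
  simp only [kernelSizePoly, kernelPoly, Polynomial.eval_add, Polynomial.eval_mul,
    Polynomial.eval_X, Polynomial.eval_C]
  omega

namespace Instance

variable (I : Instance) {d : ℕ}

theorem kernel_n_le (hG : (completeBipartiteGraph (Fin d) (Fin d)).Free I.G) :
    (I.kernel d).n ≤ (kernelPoly d).eval I.tokens := by
  obtain ⟨C, hC, hK⟩ := I.exists_isCore_vertexSet_kernelTables d
  have hn : (I.kernel d).n = #(kernelVertices I.G I.S C) := congr_arg card hK
  have hcore : #C ≤ coreBound d #I.S d := hC.card_le
  have htraces : #(univ.image (trace I.G C)) ≤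
      d * (coreBound d #I.S d + 1) ^ d + coreBound d #I.S d ^ d * (2 * d) :=
    (card_image_trace_le hG C).trans (by gcongr)
  simp only [kernelPoly, Polynomial.eval_add, Polynomial.eval_mul, Polynomial.eval_pow,
    Polynomial.eval_X, Polynomial.eval_C, Polynomial.eval_one, eval_coreBoundPoly]
  rw [hn, tokens]
  exact (card_kernelVertices_le I.G I.S C).trans (by gcongr)

theorem kernel_size_le (hG : (completeBipartiteGraph (Fin d) (Fin d)).Free I.G) :
    (I.kernel d).size ≤ (kernelSizePoly d).eval I.tokens := by
  have hn := I.kernel_n_le hG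
  have hb : (I.kernel d).b ≤ 3 * I.tokens * I.tokens := min_le_right _ _
  simp only [kernelSizePoly, Polynomial.eval_add, Polynomial.eval_mul, Polynomial.eval_X,
    Polynomial.eval_C]
  refine (I.kernel d).size_le.trans ?_
  gcongr

theorem tokens_kernel (d : ℕ) : (I.kernel d).tokens = I.tokens := by
  obtain ⟨C, -, hK⟩ := I.exists_isCore_vertexSet_kernelTables d
  refine I.tokens_restrict fun v hv => ?_
  rw [hK]
  exact mem_kernelVertices.mpr (.inr (.inl hv))

theorem isYes_kernel_iff (hG : (completeBipartiteGraph (Fin d) (Fin d)).Free I.G) :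
    (I.kernel d).IsYes ↔ I.IsYes := by
  obtain ⟨C, hC, hK⟩ := I.exists_isCore_vertexSet_kernelTables d
  exact isYes_restrict_kernelVertices_iff hC hG hK

end Instance

end DSDiscovery

theorem mainTheorem4 (𝒞 : DSDiscovery.GraphClass) (h𝒞 : 𝒞.BicliqueFree) :
    DSDiscovery.HasPolynomialKernelOn 𝒞 := by
  obtain ⟨d, hd⟩ := h𝒞
  obtain ⟨P, p, hP⟩ := (DSDiscovery.kernelCmd d).exists_program DSDiscovery.outTable
  refine ⟨P, fun I => I.kernel d, p, DSDiscovery.kernelSizePoly d, fun I hI => ?_⟩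
  have hG := hd I.n I.G hI
  exact ⟨hP _ _ (I.length_encode_kernel_le d) fun _ => I.run_kernelCmd d,
    I.isYes_kernel_iff hG,
    I.kernel_size_le hG,
    (I.tokens_kernel d).trans_le (DSDiscovery.le_eval_kernelSizePoly d I.tokens),
    ⟨I.n, I.G, hI, I.restrict_isIndContained _ _⟩⟩
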